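/- Let $n\ge 0$ and let $\mathbb A_n=\{a_1,\dots,a_n,\overline{a_1},\dots,\overline{a_n}\}$, with the involution $x\mapsto\overline x$. A *cyclic word* $c(W)$ is a finite word $W$ in $\mathbb A_n$ up to cyclic rotation; it is *reduced* if it is non-empty and all its linear representatives are freely reduced; $l(\cdot)$ denotes length. Fix a *surface symbol* $\mathcal O$: a cyclic word in which every letter of $\mathbb A_n$ appears exactly once. For a cyclic word $\mathcal W$ put $o(\mathcal W)=1$ if the letters of $\mathcal W$ are distinct and occur in $\mathcal O$ in the same cyclic order, $o(\mathcal W)=-1$ if (this is not so and) they are distinct and occur in $\mathcal O$ in the reversed cyclic order, and $o(\mathcal W)=0$ otherwise. A pair $(P,Q)$ of freely reduced linear words is *linked* if one of the following holds ($p_i,q_i$ are letters, $Y$ is a non-empty linear word with first letter $x_1$ and last letter $x_2$): 1. $P=p_1p_2$, $Q=q_1q_2$ and $o(c(\overline{p_1}\,\overline{q_1}\,p_2q_2))\ne0$; then $sign(P,Q)=o(c(\overline{p_1}\,\overline{q_1}\,p_2q_2))$. 2. $P=p_1Yp_2$, $Q=q_1Yq_2$, $p_1\ne q_1$, $p_2\neq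 q_2$ and $o(c(\overline{p_1}\,\overline{q_1}\,x_1))=o(c(p_2q_2\overline{x_2}))$; then $sign(P,Q)=o(c(\overline{p_1}\,\overline{q_1}\,x_1))$. 3. $P=p_1Yp_2$, $Q=q_1\overline Yq_2$, $p_1\ne\overline{q_2}$, $p_2\ne\overline{q_1}$ and $o(c(q_2\overline{p_1}x_1))=o(c(\overline{q_1}p_2\overline{x_2}))$; then $sign(P,Q)=o(c(q_2\overline{p_1}x_1))$. For reduced cyclic words $\mathcal W,\mathcal Z$ let $\mathbb{LP}_2(\mathcal W,\mathcal Z)$ be the set of linked pairs $(P,Q)$ in which $P$ is an occurrence of a subword of a power of $\mathcal W$ and $Q$ an occurrence of a subword of a power of $\mathcal Z$, where an occurrence is given by its length and its starting position, modulo $l(\mathcal W)$ for $P$ and modulo $l(\mathcal Z)$ for $Q$. For $(P,Q)\in\mathbb{LP}_2(\mathcal W,\mathcal Z)$ define a cyclic word $\gamma(P,Q)$: - in types 1 and 2, $\gamma(P,Q)=c(W_1Z_1)$, where $W_1$ and $Z_1$ are the representatives of $\mathcal W$ and $\mathcal Z$ obtained by cutting immediately before $p_2$ and $q_2$; - in type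 3, $\gamma(P,Q)$ is the cyclically reduced form of $c(W'Z')$, where $W'$ is the representative of $\mathcal W$ obtained by cutting right after the end of $Y$ and $Z'$ is the representative of $\mathcal Z$ obtained by cutting right before the beginning of $\overline Y$. Let $\Bbbk$ be a commutative ring and $\mathbb V$ the free $\Bbbk$-module on the reduced cyclic words (a vector space if $\Bbbk$ is a field). **Theorem.** For all reduced cyclic words $\mathcal W,\mathcal Z$ the set $\mathbb{LP}_2(\mathcal W,\mathcal Z)$ is finite and every $\gamma(P,Q)$ with $(P,Q)\in\mathbb{LP}_2(\mathcal W,\mathcal Z)$ is a reduced cyclic word. If $(P,Q)$ is of type 3 and $l(Y)\le l(\mathcal W)$ and $l(Y)\le l(\mathcal Z)$, then $\gamma(P,Q)=c(W_1Z_1)$, where $W_1$ is the part of $\mathcal W$ from right after the end of $Y$ to right before the beginning of $Y$, and $Z_1$ is the part of $\mathcal Z$ from right after the end of $\overline Y$ to right before the beginning of $\overline Y$. The bilinear bracket on $\mathbb V$ given by $$[\mathcal W,\mathcal Z]=\sum_{(P,Q)\in\mathbb{LP}_2(\mathcal W,\mathcal Z)}sign(P,Q)\,\gamma(P,Q)$$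 is well defined (independent of the choice of linear representatives), and $(\mathbb V,[\;,\;])$ is a Lie algebra: for all $x,y,z\in\mathbb V$ one has $[x,x]=0$, $[x,y]=-[y,x]$ and $[x,[y,z]]+[y,[z,x]]+[z,[x,y]]=0$. -/

import Mathlib

namespace CyclicWords

/-- The `n`-alphabet `𝔸ₙ`: `(i, true)` is the letter `aᵢ` and `(i, false)` is the letter `āᵢ`. -/
abbrev Letter (n : ℕ) : Type := Fin n × Bool

/-- The involution `x ↦ x̄` of the alphabet. -/
def bar {n : ℕ} (x : Letter n) : Letter n := (x.1, !x.2)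

/-- A cyclic word is reduced if it is non-empty and all its linear representatives are freely
reduced. -/
def IsReducedCyclic {n : ℕ} (W : Cycle (Letter n)) : Prop :=
  W ≠ Cycle.nil ∧ ∀ w : List (Letter n), (w : Cycle (Letter n)) = W → FreeGroup.IsReduced w

/-- Reduced cyclic words in the letters of `𝔸ₙ`. -/
def ReducedCyclicWord (n : ℕ) : Type := {W : Cycle (Letter n) // IsReducedCyclic W}

/-- A surface symbol: a cyclic word in which every letter of `𝔸ₙ` appears exactly once.
Adjacent mutually inverse letters are allowed. -/
def IsSurfaceSymbol {n : ℕ} (O : Cycle (Letter n)) : Prop := O.Nodup ∧ ∀ x : Letter n, x ∈ O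

/-- The letters of the cyclic word `W` map injectively and preserving the cyclic orientation to the
(equal) letters of `O`: some linear representative of `W` is a (not necessarily contiguous)
subsequence of some linear representative of `O`. -/
def OrientedIn {n : ℕ} (O W : Cycle (Letter n)) : Prop :=
  ∃ w u : List (Letter n), (w : Cycle (Letter n)) = W ∧ (u : Cycle (Letter n)) = O ∧ w.Sublist u

open Classical in
/-- The number `o(W) ∈ {-1, 0, 1}`: the orientation of the letters of `W` relative to `O`. -/
noncomputable def orient {n : ℕ} (O W : Cycle (Letter n)) : ℤ :=
  if OrientedIn O W then 1 else if OrientedIn O W.reverse then -1 else 0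

section Linked

/-! Linear words of length `m + 2` are functions on `Fin (m + 2)`. For such a word `P = p₁ Y p₂`
with `Y` of length `m` one has `p₁ = P 0`, `p₂ = P (Fin.last _)` and, if `1 ≤ m`, the first and last
letters of `Y` are `x₁ = P 1` and `x₂ = P (Fin.rev 1)`. -/

variable {n m : ℕ} (O : Cycle (Letter n)) (P Q : Fin (m + 2) → Letter n)

/-- The linear word `P` is freely reduced. -/
def IsReducedWord : Prop := ∀ t : Fin (m + 1), P t.castSucc ≠ bar (P t.succ)

/-- Type (1): `P = p₁p₂`, `Q = q₁q₂` and `o(c(p̄₁ q̄₁ p₂ q₂)) ≠ 0`. -/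
def Linked1 : Prop :=
  m = 0 ∧
  orient O ([bar (P 0), bar (Q 0), P (Fin.last _), Q (Fin.last _)] : List (Letter n)) ≠ 0

/-- Type (2): `P = p₁Yp₂`, `Q = q₁Yq₂`, `p₁ ≠ q₁`, `p₂ ≠ q₂`, with `Y` non-empty and
`o(c(p̄₁ q̄₁ x₁)) = o(c(p₂ q₂ x̄₂))`. -/
def Linked2 : Prop :=
  1 ≤ m ∧ (∀ t : Fin (m + 2), t ≠ 0 → t ≠ Fin.last _ → P t = Q t) ∧
  P 0 ≠ Q 0 ∧ P (Fin.last _) ≠ Q (Fin.last _) ∧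
  orient O ([bar (P 0), bar (Q 0), P 1] : List (Letter n)) =
    orient O ([P (Fin.last _), Q (Fin.last _), bar (P (Fin.rev 1))] : List (Letter n))

/-- Type (3): `P = p₁Yp₂`, `Q = q₁Ȳq₂`, `p₁ ≠ q̄₂`, `p₂ ≠ q̄₁`, with `Y` non-empty and
`o(c(q₂ p̄₁ x₁)) = o(c(q̄₁ p₂ x̄₂))`. -/
def Linked3 : Prop :=
  1 ≤ m ∧ (∀ t : Fin (m + 2), t ≠ 0 → t ≠ Fin.last _ → P t = bar (Q t.rev)) ∧
  P 0 ≠ bar (Q (Fin.last _)) ∧ P (Fin.last _) ≠ bar (Q 0) ∧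
  orient O ([Q (Fin.last _), bar (P 0), P 1] : List (Letter n)) =
    orient O ([bar (Q 0), P (Fin.last _), bar (P (Fin.rev 1))] : List (Letter n))

/-- The ordered pair `(P, Q)` of linear words is `O`-linked. The two words of a linked pair always
have the same length, which is at least two. -/
def Linked : Prop :=
  IsReducedWord P ∧ IsReducedWord Q ∧ (Linked1 O P Q ∨ Linked2 O P Q ∨ Linked3 O P Q)

open Classical in
/-- The sign of a linked pair (the three types are mutually exclusive). -/
noncomputable def sign : ℤ :=
  if Linked1 O P Q then
    orient O ([bar (P 0), bar (Q 0), P (Fin.last _), Q (Fin.last _)] : List (Letter n))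
  else if Linked2 O P Q then orient O ([bar (P 0), bar (Q 0), P 1] : List (Letter n))
  else if Linked3 O P Q then orient O ([Q (Fin.last _), bar (P 0), P 1] : List (Letter n))
  else 0

end Linked

/-- The linear word of length `m + 2` read along the cyclic word `c(w)`, starting at position `i`
and going around as many times as needed. These are the occurrences of subwords of the powers of
`c(w)`; positions are taken modulo the length of `w`. -/
def subword {n : ℕ} (w : List (Letter n)) (i : Fin w.length) (m : ℕ) : Fin (m + 2) → Letter n :=
  fun t => w.get ⟨(i + t) % w.length, Nat.mod_lt _ i.pos⟩

/-- The linked pairs of `c(w)` and `c(z)`: `(i, j, m)` stands for the linked pair of the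
occurrences of length `m + 2` starting at position `i` of `c(w)` and position `j` of `c(z)`. -/
def LP {n : ℕ} (O : Cycle (Letter n)) (w z : List (Letter n)) :
    Set (Fin w.length × Fin z.length × ℕ) :=
  {x | Linked O (subword w x.1 x.2.2) (subword z x.2.1 x.2.2)}

/-- The sign of a linked pair of `c(w)` and `c(z)`. -/
noncomputable def signLP {n : ℕ} (O : Cycle (Letter n)) (w z : List (Letter n))
    (x : Fin w.length × Fin z.length × ℕ) : ℤ :=
  sign O (subword w x.1 x.2.2) (subword z x.2.1 x.2.2)

open Classical in
/-- The cyclic word `γ(P, Q)` of the linked pair `x = (i, j, m)`. Recall that `p₂` and `q₂` are at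
the positions `i + m + 1` and `j + m + 1`.

For types (1) and (2) it is `c(W₁Z₁)`, where `W₁` and `Z₁` are the representatives obtained by
cutting immediately before `p₂` and `q₂`.

For type (3), with `P = p₁Yp₂` and `Q = q₁Ȳq₂`, cut `c(w)` right after the end of `Y` and `c(z)`
right before the beginning of `Ȳ`, and take the cyclically reduced form of the product. When `Y` is
not longer than `w` and `z`, the two representatives are `W₁Y` and `ȲZ₁`, and `Y` cancels
against `Ȳ`. -/
noncomputable def gamma {n : ℕ} (O : Cycle (Letter n)) (w z : List (Letter n))
    (x : Fin w.length × Fin z.length × ℕ) : Cycle (Letter n) :=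
  if Linked3 O (subword w x.1 x.2.2) (subword z x.2.1 x.2.2) then
    (FreeGroup.reduceCyclically (FreeGroup.reduce
      (w.rotate (x.1 + x.2.2 + 1) ++ z.rotate (x.2.1 + 1))) : List (Letter n))
  else
    (w.rotate (x.1 + x.2.2 + 1) ++ z.rotate (x.2.1 + x.2.2 + 1) : List (Letter n))

section Bracket

variable (k : Type*) [CommRing k]

/-- The `k`-module `𝕍` freely generated by the reduced cyclic words. -/
abbrev V (n : ℕ) : Type _ := ReducedCyclicWord n →₀ k

open Classical in
/-- A reduced cyclic word as an element of `𝕍` (and `0` for a cyclic word that is not reduced). -/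
noncomputable def ofCycle {n : ℕ} (W : Cycle (Letter n)) : V k n :=
  if h : IsReducedCyclic W then Finsupp.single ⟨W, h⟩ 1 else 0

/-- `∑_{(P, Q)} sign(P, Q) γ(P, Q)`, over the linked pairs of `c(w)` and `c(z)`. -/
noncomputable def bracketSum {n : ℕ} (O : Cycle (Letter n)) (w z : List (Letter n)) : V k n :=
  ∑ᶠ x ∈ LP O w z, signLP O w z x • ofCycle k (gamma O w z x)

/-- The bilinear bracket on `𝕍`, given on basis elements by `bracketSum`; it is computed with some
choice of linear representatives. -/
noncomputable def bracket {n : ℕ} (O : Cycle (Letter n)) : V k n →ₗ[k] V k n →ₗ[k] V k n :=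
  Finsupp.lift (V k n →ₗ[k] V k n) k (ReducedCyclicWord n) fun W =>
    Finsupp.lift (V k n) k (ReducedCyclicWord n) fun Z =>
      bracketSum k O (Quotient.out W.1) (Quotient.out Z.1)

end Bracket

end CyclicWords

/-!
The bracket is the Goldman bracket of the surface obtained from a polygon by gluing bands to it as
prescribed by the surface symbol, and it is treated here inside the free group `F` of the surface.

A letter `x` is a side of the polygon, and at each position `i` a closed word `W` describes an arc
in the polygon that comes in through the side `(W (i - 1))⁻` and leaves through the side `W i`.
Cutting the symbol open gives a linear order of the sides, with order sign `σ` (`ordSign`). The expression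
`σ(a, c) - σ(b, c) - σ(a, d) + σ(b, d)` (`crossAt`) is twice the intersection number of the arcs
`(a, b)` and `(c, d)`, where common ends count as half intersections. Summing it over all pairs of
positions of two loops, with the conjugacy class of the product of the two loops cut there as the
other factor, one gets twice the Goldman bracket (`loopBr`, `loopBr_full`). Since the expression is
additive in the ends of each arc, a pair of adjacent inverse letters contributes nothing to the sum,
so that it depends on conjugacy classes of `F` only (`walkSum`, `loopSum_conj`).

*Jacobi identity* (`loopBracket_jacobi`). In the triple bracket `[U, [W, Z]]` the terms where one
word is cut at two distinct positions occur twice with opposite signs in the cyclic sum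
(`doubleCut_symm`). In the other terms the three words follow each other, and because of
`σ(x, y) σ(y, z) + σ(y, z) σ(z, x) + σ(z, x) σ(x, y) = -1` unless `x = y = z`, their coefficients
add up to zero except for triples of arcs with a common side (`cyclic_sum_ordSign`). Following three
such arcs through the common side pairs off these exceptions with opposite signs (`sum_common_end`).

*Linked pairs* (`two_smul_sum_LP`). Pairs of positions whose arcs share a side are organized in
maximal runs, along which the two words are parallel or antiparallel; the product class is
constant along a run, and only the two ends of a run contribute, each with a sign. The signs cancel unless the run is
the word `Y` of a linked pair of type 2 or 3, and then they add up to twice the sign of the pair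
(`sum_run_ends`). Arcs without common sides give the linked pairs of type 1.

Since cyclically reduced words are conjugate only if they are rotations of each other
(`cycleCls_injOn`), the free `ℤ`-module on the reduced cyclic words embeds into the one on the
conjugacy classes. Both are torsion-free, so the factors of two can be cancelled, and the identities
over `ℤ` imply those over every commutative ring by extension of scalars.
-/

namespace CyclicWords

/-! ### Sums over the letters of a loop -/

section WalkSum

variable {n : ℕ} {A : Type*} [AddCommGroup A]

/-- A letter as an element of the free group. -/
def letterElt (x : Letter n) : FreeGroup (Fin n) := FreeGroup.mk [x]

theorem bar_bar (x : Letter n) : bar (bar x) = x := by simp [bar]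

theorem bar_ne (x : Letter n) : bar x ≠ x := by
  intro h
  have := congrArg Prod.snd h
  simp [bar] at this

theorem bar_injective : Function.Injective (bar : Letter n → Letter n) := fun x y h => by
  rw [← bar_bar x, h, bar_bar]

theorem letterElt_bar (x : Letter n) : letterElt (bar x) = (letterElt x)⁻¹ := by
  simp [letterElt, bar, FreeGroup.inv_mk, FreeGroup.invRev]

/-- Read the word `L` along a loop whose class based at the starting point of `L` is `k`, and sum up
the two ends of every letter `x`: the far end `x̄` with sign `1` and the near end `x` with
sign `-1`, each with the class of the loop based at that end. -/
def walkSumList (ψ : Letter n → FreeGroup (Fin n) → A) :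
    List (Letter n) → FreeGroup (Fin n) → A
  | [], _ => 0
  | x :: L, k => ψ (bar x) ((letterElt x)⁻¹ * k * letterElt x) - ψ x k +
      walkSumList ψ L ((letterElt x)⁻¹ * k * letterElt x)

theorem walkSumList_append (ψ : Letter n → FreeGroup (Fin n) → A) (L₁ L₂ : List (Letter n))
    (k : FreeGroup (Fin n)) :
    walkSumList ψ (L₁ ++ L₂) k = walkSumList ψ L₁ k +
      walkSumList ψ L₂ ((FreeGroup.mk L₁)⁻¹ * k * FreeGroup.mk L₁) := by
  induction L₁ generalizing k with
  | nil => simp [walkSumList, ← FreeGroup.one_eq_mk]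
  | cons x L ih =>
    have h : FreeGroup.mk (x :: L) = letterElt x * FreeGroup.mk L := by
      simp [letterElt, FreeGroup.mul_mk]
    simp only [List.cons_append, walkSumList, ih, h, mul_inv_rev, add_assoc, mul_assoc]

theorem walkSumList_step (ψ : Letter n → FreeGroup (Fin n) → A) {L₁ L₂ : List (Letter n)}
    (h : FreeGroup.Red.Step L₁ L₂) (k : FreeGroup (Fin n)) :
    walkSumList ψ L₁ k = walkSumList ψ L₂ k := by
  obtain @⟨L₁, L₂, x, b⟩ := h
  have hc : ∀ k', walkSumList ψ ((x, b) :: (x, !b) :: L₂) k' = walkSumList ψ L₂ k' := by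
    intro k'
    have h1 : bar ((x, b) : Letter n) = (x, !b) := rfl
    have h2 : bar ((x, !b) : Letter n) = (x, b) := by simp [bar]
    have h3 : letterElt ((x, !b) : Letter n) = (letterElt (x, b))⁻¹ := letterElt_bar (x, b)
    simp only [walkSumList, h1, h2, h3, inv_inv]
    have h4 : letterElt ((x, b) : Letter n) * ((letterElt (x, b))⁻¹ * k' * letterElt (x, b)) *
        (letterElt (x, b))⁻¹ = k' := by group
    rw [h4]
    abel
  rw [walkSumList_append, hc, walkSumList_append]

/-- `walkSumList` depends only on the element of the free group that the word represents, since
the contributions of two adjacent inverse letters cancel. -/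
def walkSum (ψ : Letter n → FreeGroup (Fin n) → A) (g k : FreeGroup (Fin n)) : A :=
  Quot.liftOn g (fun L => walkSumList ψ L k) fun _ _ h => walkSumList_step ψ h k

theorem walkSum_mk (ψ : Letter n → FreeGroup (Fin n) → A) (L : List (Letter n))
    (k : FreeGroup (Fin n)) : walkSum ψ (FreeGroup.mk L) k = walkSumList ψ L k := rfl

theorem walkSum_one (ψ : Letter n → FreeGroup (Fin n) → A) (k : FreeGroup (Fin n)) :
    walkSum ψ 1 k = 0 := rfl

theorem walkSum_mul (ψ : Letter n → FreeGroup (Fin n) → A) (g h k : FreeGroup (Fin n)) :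
    walkSum ψ (g * h) k = walkSum ψ g k + walkSum ψ h (g⁻¹ * k * g) := by
  induction g using Quot.inductionOn with
  | h L₁ =>
    induction h using Quot.inductionOn with
    | h L₂ => exact walkSumList_append ψ L₁ L₂ k

theorem walkSum_letterElt (ψ : Letter n → FreeGroup (Fin n) → A) (x : Letter n)
    (k : FreeGroup (Fin n)) : walkSum ψ (letterElt x) k =
      ψ (bar x) ((letterElt x)⁻¹ * k * letterElt x) - ψ x k := by
  simp [letterElt, walkSum_mk, walkSumList]

theorem walkSum_sub (ψ₁ ψ₂ : Letter n → FreeGroup (Fin n) → A) (g k : FreeGroup (Fin n)) :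
    walkSum (fun x a => ψ₁ x a - ψ₂ x a) g k = walkSum ψ₁ g k - walkSum ψ₂ g k := by
  induction g using Quot.inductionOn with
  | h L =>
    change walkSumList _ L k = walkSumList _ L k - walkSumList _ L k
    induction L generalizing k with
    | nil => simp [walkSumList]
    | cons x L ih => simp only [walkSumList, ih]; abel

/-- The sum of `ψ` over all ends of letters of the loop represented by `g`. -/
def loopSum (ψ : Letter n → FreeGroup (Fin n) → A) (g : FreeGroup (Fin n)) : A := walkSum ψ g g

/-- The contributions of the conjugating word and of its inverse cancel. -/
theorem loopSum_conj (ψ : Letter n → FreeGroup (Fin n) → A) (g c : FreeGroup (Fin n)) :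
    loopSum ψ (c * g * c⁻¹) = loopSum ψ g := by
  have h0 := walkSum_mul ψ c c⁻¹ (c * g * c⁻¹)
  rw [mul_inv_cancel, walkSum_one] at h0
  have h1 : c⁻¹ * (c * g * c⁻¹) * c = g := by group
  have h2 : (c * g)⁻¹ * (c * g * c⁻¹) * (c * g) = g := by group
  rw [h1] at h0
  rw [loopSum, walkSum_mul, walkSum_mul, h1, h2, loopSum, add_right_comm, ← h0, zero_add]

theorem loopSum_eq_of_isConj (ψ : Letter n → FreeGroup (Fin n) → A) {g h : FreeGroup (Fin n)}
    (hgh : IsConj g h) : loopSum ψ g = loopSum ψ h := by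
  obtain ⟨c, rfl⟩ := isConj_iff.1 hgh
  rw [loopSum_conj]

end WalkSum

/-! ### Closed words -/

section ClosedWord

variable {n : ℕ} {A : Type*} [AddCommGroup A] {N : ℕ}

/-- The product of `d` consecutive letters of the closed word `W`, from position `i` on. -/
def seg (W : ZMod N → Letter n) (i : ZMod N) : ℕ → FreeGroup (Fin n)
  | 0 => 1
  | d + 1 => seg W i d * letterElt (W (i + d))

/-- The element of the free group represented by the closed word `W` cut before position `i`. -/
def full (W : ZMod N → Letter n) (i : ZMod N) : FreeGroup (Fin n) := seg W i N

theorem seg_add (W : ZMod N → Letter n) (i : ZMod N) (d d' : ℕ) :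
    seg W i (d + d') = seg W i d * seg W (i + d) d' := by
  induction d' with
  | zero => simp [seg]
  | succ d' ih => rw [← add_assoc, seg, ih, seg, mul_assoc]; push_cast; rw [add_assoc]

theorem seg_one (W : ZMod N → Letter n) (i : ZMod N) : seg W i 1 = letterElt (W i) := by
  simp [seg]

theorem seg_conj_full (W : ZMod N → Letter n) (i : ZMod N) (t : ℕ) :
    (seg W i t)⁻¹ * full W i * seg W i t = full W (i + t) := by
  have h1 := seg_add W i N t
  have h2 := seg_add W i t N
  rw [add_comm, h2] at h1
  rw [ZMod.natCast_self, add_zero] at h1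
  rw [full, mul_assoc, ← h1, inv_mul_cancel_left, full]

theorem walkSum_seg (ψ : Letter n → FreeGroup (Fin n) → A) (W : ZMod N → Letter n) (i : ZMod N)
    (d : ℕ) (k : FreeGroup (Fin n)) :
    walkSum ψ (seg W i d) k = ∑ t ∈ Finset.range d,
      (ψ (bar (W (i + t))) ((seg W i (t + 1))⁻¹ * k * seg W i (t + 1)) -
        ψ (W (i + t)) ((seg W i t)⁻¹ * k * seg W i t)) := by
  induction d with
  | zero => simp [seg, walkSum_one]
  | succ d ih =>
    rw [Finset.sum_range_succ, ← ih]
    conv_lhs => rw [seg, walkSum_mul, walkSum_letterElt]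
    simp only [seg, mul_inv_rev, mul_assoc]

theorem sum_range_zmod [NeZero N] (f : ZMod N → A) (i : ZMod N) :
    ∑ t ∈ Finset.range N, f (i + t) = ∑ x, f x := by
  rw [← Equiv.sum_comp (Equiv.addLeft i) f]
  refine Finset.sum_nbij' (fun t => (t : ZMod N)) (fun x => x.val) ?_ ?_ ?_ ?_ ?_
  · simp
  · intro x _; simpa using ZMod.val_lt x
  · intro t ht; exact ZMod.val_cast_of_lt (by simpa using ht)
  · intro x _; simp
  · intro t _; simp

theorem loopSum_full [NeZero N] (ψ : Letter n → FreeGroup (Fin n) → A) (W : ZMod N → Letter n)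
    (i : ZMod N) :
    loopSum ψ (full W i) =
      ∑ x, (ψ (bar (W (x - 1))) (full W x) - ψ (W x) (full W x)) := by
  rw [loopSum]
  conv_lhs => enter [2]; rw [full]
  rw [walkSum_seg]
  simp only [seg_conj_full, Finset.sum_sub_distrib]
  congr 1
  · rw [← sum_range_zmod _ (i + 1)]
    refine Finset.sum_congr rfl fun t _ => ?_
    push_cast
    rw [show i + 1 + (t : ZMod N) - 1 = i + t by ring,
      show i + 1 + (t : ZMod N) = i + (t + 1) by ring]
  · exact sum_range_zmod (fun x => ψ (W x) (full W x)) i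

end ClosedWord

/-! ### The bracket of conjugacy classes -/

section LoopBracket

variable {n : ℕ} (p : Letter n → ℤ)

/-- The conjugacy class of `g`, as an element of the free module on the conjugacy classes. -/
noncomputable def cls (g : FreeGroup (Fin n)) : ConjClasses (FreeGroup (Fin n)) →₀ ℤ :=
  Finsupp.single (ConjClasses.mk g) 1

theorem cls_eq_of_isConj {g h : FreeGroup (Fin n)} (hgh : IsConj g h) : cls g = cls h := by
  rw [cls, cls, ConjClasses.mk_eq_mk_iff_isConj.2 hgh]

theorem cls_mul_comm (g h : FreeGroup (Fin n)) : cls (g * h) = cls (h * g) :=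
  cls_eq_of_isConj (isConj_iff.2 ⟨h, by group⟩)

theorem cls_conj (g c : FreeGroup (Fin n)) : cls (c⁻¹ * g * c) = cls g :=
  cls_eq_of_isConj (isConj_iff.2 ⟨c, by group⟩)

/-- The sign that tells which one of two letters comes first in the linear order of the letters
given by `p`. -/
def ordSign (x y : Letter n) : ℤ := (p y - p x).sign

theorem ordSign_swap (x y : Letter n) : ordSign p y x = -ordSign p x y := by
  rw [ordSign, ordSign, ← Int.sign_neg, neg_sub]

theorem ordSign_cases (x y : Letter n) : (p x < p y ∧ ordSign p x y = 1) ∨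
    (p x = p y ∧ ordSign p x y = 0) ∨ (p y < p x ∧ ordSign p x y = -1) := by
  rcases lt_trichotomy (p x) (p y) with h | h | h
  · exact .inl ⟨h, Int.sign_eq_one_of_pos (sub_pos.2 h)⟩
  · exact .inr (.inl ⟨h, by rw [ordSign, h, sub_self, Int.sign_zero]⟩)
  · exact .inr (.inr ⟨h, Int.sign_eq_neg_one_of_neg (sub_neg.2 h)⟩)

/-- Twice the Goldman bracket of two loops. -/
noncomputable def loopBr (g h : FreeGroup (Fin n)) : ConjClasses (FreeGroup (Fin n)) →₀ ℤ :=
  loopSum (fun x a => loopSum (fun y b => ordSign p x y • cls (a * b)) h) g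

theorem loopBr_eq_of_isConj {g g' h h' : FreeGroup (Fin n)} (hg : IsConj g g')
    (hh : IsConj h h') : loopBr p g h = loopBr p g' h' := by
  rw [loopBr, loopSum_eq_of_isConj _ hg]
  simp only [loopSum_eq_of_isConj _ hh]
  rfl

/-- The bilinear extension of `loopBr` to the free module on the conjugacy classes. -/
noncomputable def loopBracket :
    (ConjClasses (FreeGroup (Fin n)) →₀ ℤ) →ₗ[ℤ] (ConjClasses (FreeGroup (Fin n)) →₀ ℤ) →ₗ[ℤ]
      (ConjClasses (FreeGroup (Fin n)) →₀ ℤ) :=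
  Finsupp.lift _ ℤ _ fun C => Finsupp.lift _ ℤ _ fun C' =>
    Quotient.liftOn₂ C C' (loopBr p) fun _ _ _ _ hg hh => loopBr_eq_of_isConj p hg hh

theorem loopBracket_cls (g h : FreeGroup (Fin n)) :
    loopBracket p (cls g) (cls h) = loopBr p g h := by
  rw [loopBracket, cls, cls, Finsupp.lift_apply, Finsupp.sum_single_index (by rw [zero_smul]),
    one_smul, Finsupp.lift_apply, Finsupp.sum_single_index (by rw [zero_smul]), one_smul]
  rfl

/-! ### The bracket in terms of pairs of positions -/

/-- The difference of the order signs of `x` relative to the two ends of the arc that the closed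
word `W` describes at position `i` inside the polygon with sides labelled by the letters: the arc
comes in through the side `(W (i - 1))⁻` and leaves through the side `W i`. -/
def side {N : ℕ} (W : ZMod N → Letter n) (i : ZMod N) (x : Letter n) : ℤ :=
  ordSign p (bar (W (i - 1))) x - ordSign p (W i) x

/-- Twice the signed intersection number of the arcs of the closed words `W` and `Z` at the
positions `i` and `j`; common ends of arcs count as half intersections. -/
def crossAt {N M : ℕ} (W : ZMod N → Letter n) (i : ZMod N) (Z : ZMod M → Letter n) (j : ZMod M) :
    ℤ :=
  side p W i (bar (Z (j - 1))) - side p W i (Z j)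

theorem crossAt_swap {N M : ℕ} (W : ZMod N → Letter n) (i : ZMod N) (Z : ZMod M → Letter n)
    (j : ZMod M) : crossAt p Z j W i = -crossAt p W i Z j := by
  simp only [crossAt, side]
  rw [ordSign_swap p (bar (W (i - 1))) (bar (Z (j - 1))), ordSign_swap p (W i) (bar (Z (j - 1))),
    ordSign_swap p (bar (W (i - 1))) (Z j), ordSign_swap p (W i) (Z j)]
  ring

variable {A B C : ℕ} [NeZero A] [NeZero B] [NeZero C]

theorem loopBr_full_left (U : ZMod A → Letter n) (i : ZMod A) (h : FreeGroup (Fin n)) :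
    loopBr p (full U i) h =
      ∑ a, loopSum (fun y b => side p U a y • cls (full U a * b)) h := by
  rw [loopBr, loopSum_full]
  refine Finset.sum_congr rfl fun a _ => ?_
  rw [loopSum, loopSum, ← walkSum_sub, loopSum]
  simp only [side, sub_smul]

theorem loopBr_full (W : ZMod B → Letter n) (Z : ZMod C → Letter n) (i : ZMod B) (j : ZMod C) :
    loopBr p (full W i) (full Z j) =
      ∑ x, ∑ y, crossAt p W x Z y • cls (full W x * full Z y) := by
  rw [loopBr_full_left]
  refine Finset.sum_congr rfl fun x _ => ?_
  rw [loopSum_full]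
  simp only [crossAt, sub_smul]

theorem loopBr_full_swap (W : ZMod B → Letter n) (Z : ZMod C → Letter n) (i : ZMod B)
    (j : ZMod C) : loopBr p (full Z j) (full W i) = -loopBr p (full W i) (full Z j) := by
  rw [loopBr_full, loopBr_full, Finset.sum_comm, ← Finset.sum_neg_distrib]
  refine Finset.sum_congr rfl fun x _ => ?_
  rw [← Finset.sum_neg_distrib]
  refine Finset.sum_congr rfl fun y _ => ?_
  rw [crossAt_swap, neg_smul, cls_mul_comm]

/-! ### The Jacobi identity -/

theorem walkSum_full_mul {M : Type*} [AddCommGroup M] (ψ : Letter n → FreeGroup (Fin n) → M)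
    (W : ZMod B → Letter n) (i : ZMod B) (h : FreeGroup (Fin n)) :
    walkSum ψ (full W i) (full W i * h) =
      ψ (bar (W (i - 1))) (h * full W i) - ψ (W i) (full W i * h) +
      ∑ t ∈ Finset.Ico 1 B,
        (ψ (bar (W (i + t - 1))) (seg W (i + t) (B - t) * h * seg W i t) -
          ψ (W (i + t)) (seg W (i + t) (B - t) * h * seg W i t)) := by
  have hB : 0 < B := Nat.pos_of_ne_zero (NeZero.ne B)
  set f : ℕ → M := fun t => ψ (bar (W (i + t - 1))) ((seg W i t)⁻¹ * (full W i * h) * seg W i t)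
  set g : ℕ → M := fun t => ψ (W (i + t)) ((seg W i t)⁻¹ * (full W i * h) * seg W i t)
  have h1 : walkSum ψ (full W i) (full W i * h) =
      ∑ t ∈ Finset.Ico 0 B, (f (t + 1) - g t) := by
    conv_lhs => enter [2]; rw [full]
    rw [walkSum_seg, Finset.range_eq_Ico]
    refine Finset.sum_congr rfl fun t _ => ?_
    simp only [f, g]
    push_cast
    rw [show i + ((t : ZMod B) + 1) - 1 = i + t by ring]
  have hf : ∑ t ∈ Finset.Ico 0 B, f (t + 1) = ∑ t ∈ Finset.Ico 1 B, f t + f B := by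
    rw [Finset.sum_Ico_add' f 0 B 1, ← Finset.sum_Ico_succ_top (by omega)]
  have hg : ∑ t ∈ Finset.Ico 0 B, g t = g 0 + ∑ t ∈ Finset.Ico 1 B, g t :=
    Finset.sum_eq_sum_Ico_succ_bot hB g
  have hk : ∀ t ∈ Finset.Ico 1 B, (seg W i t)⁻¹ * (full W i * h) * seg W i t =
      seg W (i + t) (B - t) * h * seg W i t := by
    intro t ht
    have ht' : t + (B - t) = B := by have := (Finset.mem_Ico.1 ht).2; omega
    have := seg_add W i t (B - t)
    rw [ht'] at this
    rw [full, this]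
    group
  have hfB : f B = ψ (bar (W (i - 1))) (h * full W i) := by
    simp only [f, ZMod.natCast_self, add_zero]
    rw [show seg W i B = full W i from rfl]
    congr 1
    group
  have hg0 : g 0 = ψ (W i) (full W i * h) := by simp [g, seg]
  rw [h1, Finset.sum_sub_distrib, hf, hg, hfB, hg0, Finset.sum_sub_distrib]
  rw [Finset.sum_congr rfl fun t ht => show f t = ψ (bar (W (i + t - 1)))
      (seg W (i + t) (B - t) * h * seg W i t) by simp only [f]; rw [hk t ht],
    Finset.sum_congr rfl fun t ht => show g t = ψ (W (i + t))
      (seg W (i + t) (B - t) * h * seg W i t) by simp only [g]; rw [hk t ht]]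
  abel

/-- The terms of `[U, [W, Z]]` in which `W` is cut at two distinct positions, one of which is glued
to `Z` and the other one to `U`. -/
noncomputable def doubleCut (U : ZMod A → Letter n) (W : ZMod B → Letter n)
    (Z : ZMod C → Letter n) : ConjClasses (FreeGroup (Fin n)) →₀ ℤ :=
  ∑ a, ∑ i, ∑ j, ∑ t ∈ Finset.Ico 1 B, (crossAt p W i Z j * crossAt p U a W (i + (t : ZMod B))) •
    cls (full U a * (seg W (i + t) (B - t) * full Z j * seg W i t))

/-- The terms of `[U, [W, Z]]` in which `U` is glued to the place where `Z` is followed by `W`, and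
which therefore contain the words `U`, `W` and `Z` one after another. -/
noncomputable def joinCut (U : ZMod A → Letter n) (W : ZMod B → Letter n)
    (Z : ZMod C → Letter n) : ConjClasses (FreeGroup (Fin n)) →₀ ℤ :=
  ∑ a, ∑ i, ∑ j,
    (crossAt p W i Z j * (side p U a (bar (Z (j - 1))) - side p U a (W i))) •
      cls (full U a * full W i * full Z j)

theorem loopBracket_loopBr (U : ZMod A → Letter n) (W : ZMod B → Letter n)
    (Z : ZMod C → Letter n) (a₀ : ZMod A) (i₀ : ZMod B) (j₀ : ZMod C) :
    loopBracket p (cls (full U a₀)) (loopBr p (full W i₀) (full Z j₀)) =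
      joinCut p U W Z - joinCut p U Z W + doubleCut p U W Z - doubleCut p U Z W := by
  have h1 : ∀ a i j, loopSum (fun y b => side p U a y • cls (full U a * b)) (full W i * full Z j) =
      ((side p U a (bar (Z (j - 1))) - side p U a (W i)) •
          cls (full U a * full W i * full Z j) +
        (side p U a (bar (W (i - 1))) - side p U a (Z j)) •
          cls (full U a * full Z j * full W i)) +
      ∑ t ∈ Finset.Ico 1 B, crossAt p U a W (i + (t : ZMod B)) •
        cls (full U a * (seg W (i + t) (B - t) * full Z j * seg W i t)) +
      ∑ t ∈ Finset.Ico 1 C, crossAt p U a Z (j + (t : ZMod C)) •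
        cls (full U a * (seg Z (j + t) (C - t) * full W i * seg Z j t)) := by
    intro a i j
    rw [loopSum, walkSum_mul, show (full W i)⁻¹ * (full W i * full Z j) * full W i =
      full Z j * full W i by group, walkSum_full_mul, walkSum_full_mul]
    simp only [crossAt, sub_smul, ← mul_assoc]
    abel
  rw [loopBr_full]
  simp only [map_sum, map_smul, loopBracket_cls]
  simp only [loopBr_full_left, h1, Finset.smul_sum]
  rw [(Finset.sum_congr rfl fun i _ => Finset.sum_comm).trans Finset.sum_comm]
  have h2 : doubleCut p U Z W = ∑ a, ∑ i, ∑ j, ∑ t ∈ Finset.Ico 1 C,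
      (crossAt p Z j W i * crossAt p U a Z (j + (t : ZMod C))) •
        cls (full U a * (seg Z (j + t) (C - t) * full W i * seg Z j t)) :=
    Finset.sum_congr rfl fun a _ => Finset.sum_comm
  have h3 : joinCut p U Z W = ∑ a, ∑ i, ∑ j,
      (crossAt p Z j W i * (side p U a (bar (W (i - 1))) - side p U a (Z j))) •
        cls (full U a * full Z j * full W i) :=
    Finset.sum_congr rfl fun a _ => Finset.sum_comm
  rw [h2, h3, joinCut, doubleCut]
  simp only [← Finset.sum_add_distrib, ← Finset.sum_sub_distrib]
  refine Finset.sum_congr rfl fun a _ => Finset.sum_congr rfl fun i _ =>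
    Finset.sum_congr rfl fun j _ => ?_
  simp only [crossAt_swap p W i Z j, neg_mul, neg_smul, Finset.sum_neg_distrib, sub_neg_eq_add,
    smul_add, Finset.smul_sum, mul_smul]

/-- Each term of the double cuts of `W` in `[U, [W, Z]]` is also a term of the double cuts of `W` in
`[Z, [U, W]]`, where the two cuts have exchanged their roles. -/
theorem doubleCut_symm (U : ZMod A → Letter n) (W : ZMod B → Letter n)
    (Z : ZMod C → Letter n) : doubleCut p U W Z = doubleCut p Z W U := by
  have key : ∀ a j, (∑ i, ∑ t ∈ Finset.Ico 1 B,
      (crossAt p W i Z j * crossAt p U a W (i + (t : ZMod B))) •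
        cls (full U a * (seg W (i + t) (B - t) * full Z j * seg W i t))) =
      ∑ i, ∑ t ∈ Finset.Ico 1 B, (crossAt p W i U a * crossAt p Z j W (i + (t : ZMod B))) •
        cls (full Z j * (seg W (i + t) (B - t) * full U a * seg W i t)) := by
    intro a j
    rw [Finset.sum_comm, Finset.sum_comm (s := Finset.univ) (t := Finset.Ico 1 B)]
    -- Exchange the two cuts: the cuts at `i` and `i + t` are the cuts at `i'` and `i' + (B - t)`
    -- with `i' = i + t`.
    refine Finset.sum_nbij' (fun t => B - t) (fun t => B - t) ?_ ?_ ?_ ?_ ?_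
    · intro t ht; rw [Finset.mem_Ico] at ht ⊢; omega
    · intro t ht; rw [Finset.mem_Ico] at ht ⊢; omega
    · intro t ht; rw [Finset.mem_Ico] at ht; omega
    · intro t ht; rw [Finset.mem_Ico] at ht; omega
    intro t ht
    rw [Finset.mem_Ico] at ht
    symm
    rw [← Equiv.sum_comp (Equiv.addRight (t : ZMod B))]
    refine Finset.sum_congr rfl fun i _ => ?_
    simp only [Equiv.coe_addRight, Nat.cast_sub ht.2.le, ZMod.natCast_self,
      Nat.sub_sub_self ht.2.le, show i + (t : ZMod B) + (0 - t) = i by ring]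
    rw [crossAt_swap p U a W (i + t), crossAt_swap p W i Z j]
    congr 1
    · ring
    · have := cls_mul_comm (full Z j * seg W i t) (full U a * seg W (i + t) (B - t))
      simpa only [mul_assoc] using this
  rw [doubleCut, doubleCut, Finset.sum_congr rfl fun a _ => Finset.sum_comm, Finset.sum_comm]
  conv_rhs => rw [Finset.sum_congr rfl fun a _ => Finset.sum_comm]
  exact Finset.sum_congr rfl fun j _ => Finset.sum_congr rfl fun a _ => key a j

/-- The indicator function of the coincidence of three sides of the polygon. -/
def coincide (x y z : Letter n) : ℤ := if x = y ∧ y = z then 1 else 0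

/-- A cyclic sum of products of crossing numbers of three arcs `(a₁, b₁)`, `(a₂, b₂)`, `(a₃, b₃)`
with coinciding ends: it vanishes unless one end of each of the three arcs coincide. It follows from
`σ(x, y) σ(y, z) + σ(y, z) σ(z, x) + σ(z, x) σ(x, y) = -1` unless `x = y = z`, for the order
sign `σ`. -/
theorem cyclic_sum_ordSign (hp : Function.Injective p) (a₁ b₁ a₂ b₂ a₃ b₃ : Letter n) :
    let s := ordSign p
    let δ := coincide (n := n)
    (s a₂ a₃ - s b₂ a₃ - (s a₂ b₃ - s b₂ b₃)) * ((s a₁ a₃ - s b₁ a₃) - (s a₁ b₂ - s b₁ b₂)) +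
    (s a₃ a₁ - s b₃ a₁ - (s a₃ b₁ - s b₃ b₁)) * ((s a₂ a₁ - s b₂ a₁) - (s a₂ b₃ - s b₂ b₃)) +
    (s a₁ a₂ - s b₁ a₂ - (s a₁ b₂ - s b₁ b₂)) * ((s a₃ a₂ - s b₃ a₂) - (s a₃ b₁ - s b₃ b₁)) =
    -(δ a₁ a₂ a₃ - δ b₁ a₂ a₃ - δ a₁ b₂ a₃ - δ a₁ a₂ b₃ + δ a₁ b₂ b₃ + δ b₁ a₂ b₃ +
      δ b₁ b₂ a₃ - δ b₁ b₂ b₃) := by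
  intro s δ
  have h : ∀ x y z, s x y * s y z + s y z * s z x + s z x * s x y = δ x y z - 1 := by
    intro x y z
    have hxy : x = y ↔ p x = p y := hp.eq_iff.symm
    have hyz : y = z ↔ p y = p z := hp.eq_iff.symm
    simp only [s, δ, coincide, hxy, hyz]
    rcases ordSign_cases p x y with ⟨h1, e1⟩ | ⟨h1, e1⟩ | ⟨h1, e1⟩ <;>
    rcases ordSign_cases p y z with ⟨h2, e2⟩ | ⟨h2, e2⟩ | ⟨h2, e2⟩ <;>
    rcases ordSign_cases p z x with ⟨h3, e3⟩ | ⟨h3, e3⟩ | ⟨h3, e3⟩ <;>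
    rw [e1, e2, e3] <;> split_ifs <;> omega
  have hs : ∀ x y, s y x = -s x y := ordSign_swap p
  rw [hs a₃ a₁, hs a₃ b₁, hs a₁ a₂, hs a₁ b₂, hs a₂ a₃, hs a₂ b₃]
  linear_combination (-1) * (h a₁ a₂ a₃ - h b₁ a₂ a₃ - h a₁ b₂ a₃ - h a₁ a₂ b₃ + h a₁ b₂ b₃ +
    h b₁ a₂ b₃ + h b₁ b₂ a₃ - h b₁ b₂ b₃)

/-- The side of the polygon at one of the two ends of the arc of the closed word `W` at position
`i`: where the arc comes in (`true`) or where it leaves (`false`). -/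
def arcEnd {N : ℕ} (W : ZMod N → Letter n) : Bool × ZMod N → Letter n
  | (true, i) => bar (W (i - 1))
  | (false, i) => W i

/-- The sign of an end of an arc. -/
def endSign {N : ℕ} : Bool × ZMod N → ℤ
  | (true, _) => 1
  | (false, _) => -1

/-- Cross the side of the polygon at the end of an arc, and arrive at an end of the adjacent arc. -/
def crossSide (N : ℕ) : Equiv.Perm (Bool × ZMod N) where
  toFun e := (!e.1, if e.1 then e.2 - 1 else e.2 + 1)
  invFun e := (!e.1, if e.1 then e.2 - 1 else e.2 + 1)
  left_inv := by rintro ⟨_ | _, i⟩ <;> simp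
  right_inv := by rintro ⟨_ | _, i⟩ <;> simp

theorem arcEnd_crossSide {N : ℕ} (W : ZMod N → Letter n) (e : Bool × ZMod N) :
    arcEnd W (crossSide N e) = bar (arcEnd W e) := by
  obtain ⟨_ | _, i⟩ := e <;> simp [crossSide, arcEnd, bar_bar]

theorem endSign_crossSide {N : ℕ} (e : Bool × ZMod N) : endSign (crossSide N e) = -endSign e := by
  obtain ⟨_ | _, i⟩ := e <;> simp [crossSide, endSign]

theorem full_crossSide {N : ℕ} (W : ZMod N → Letter n) (e : Bool × ZMod N) :
    full W (crossSide N e).2 =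
      (letterElt (arcEnd W e))⁻¹ * full W e.2 * letterElt (arcEnd W e) := by
  obtain ⟨_ | _, i⟩ := e
  · have := seg_conj_full W i 1
    rw [seg_one, Nat.cast_one] at this
    simp [crossSide, arcEnd, this]
  · have := seg_conj_full W (i - 1) 1
    rw [seg_one, Nat.cast_one, sub_add_cancel] at this
    simp only [crossSide, arcEnd, letterElt_bar, inv_inv, Equiv.coe_fn_mk, if_true, ← this]
    group

/-- The triples of ends of arcs at a common side of the polygon contribute nothing: the three arcs
can be followed together through that side, which changes the signs of the three ends. -/
theorem sum_common_end (U : ZMod A → Letter n) (W : ZMod B → Letter n) (Z : ZMod C → Letter n) :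
    ∑ e, ∑ f, ∑ g, (endSign e * endSign f * endSign g *
      coincide (arcEnd U e) (arcEnd W f) (arcEnd Z g)) •
        cls (full U e.2 * full W f.2 * full Z g.2) = 0 := by
  set F : Bool × ZMod A → Bool × ZMod B → Bool × ZMod C →
      (ConjClasses (FreeGroup (Fin n)) →₀ ℤ) := fun e f g =>
    (endSign e * endSign f * endSign g *
      coincide (arcEnd U e) (arcEnd W f) (arcEnd Z g)) •
        cls (full U e.2 * full W f.2 * full Z g.2)
  have hF : ∀ e f g, F (crossSide A e) (crossSide B f) (crossSide C g) = -F e f g := by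
    intro e f g
    simp only [F, coincide, arcEnd_crossSide, endSign_crossSide, bar_injective.eq_iff]
    split_ifs with h
    · rw [full_crossSide, full_crossSide, full_crossSide, ← h.2, ← h.1, ← neg_smul]
      congr 1
      · ring
      · rw [← cls_conj (full U e.2 * full W f.2 * full Z g.2) (letterElt (arcEnd U e))]
        congr 1
        group
    · simp
  have h : ∑ e, ∑ f, ∑ g, F e f g = -∑ e, ∑ f, ∑ g, F e f g := by
    conv_lhs =>
      rw [← Equiv.sum_comp (crossSide A)]
      enter [2, e]
      rw [← Equiv.sum_comp (crossSide B)]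
      enter [2, f]
      rw [← Equiv.sum_comp (crossSide C)]
      enter [2, g]
      rw [hF]
    simp only [Finset.sum_neg_distrib]
  change ∑ e, ∑ f, ∑ g, F e f g = 0
  ext c
  have := DFunLike.congr_fun h c
  rw [Finsupp.neg_apply] at this
  rw [Finsupp.zero_apply]
  omega

/-- The words `U`, `W`, `Z` occur in this cyclic order in three of the terms for each triple of
positions; the coefficients add up to those of `sum_common_end`. -/
theorem joinCut_cyclic (hp : Function.Injective p) (U : ZMod A → Letter n) (W : ZMod B → Letter n)
    (Z : ZMod C → Letter n) : joinCut p U W Z + joinCut p W Z U + joinCut p Z U W = 0 := by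
  have h1 : joinCut p W Z U = ∑ a, ∑ i, ∑ j,
      (crossAt p Z j U a * (side p W i (bar (U (a - 1))) - side p W i (Z j))) •
        cls (full U a * full W i * full Z j) := by
    rw [joinCut, Finset.sum_congr rfl fun i _ => Finset.sum_comm, Finset.sum_comm]
    refine Finset.sum_congr rfl fun a _ => Finset.sum_congr rfl fun i _ =>
      Finset.sum_congr rfl fun j _ => ?_
    rw [cls_mul_comm, mul_assoc]
  have h2 : joinCut p Z U W = ∑ a, ∑ i, ∑ j,
      (crossAt p U a W i * (side p Z j (bar (W (i - 1))) - side p Z j (U a))) •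
        cls (full U a * full W i * full Z j) := by
    rw [joinCut, Finset.sum_comm, Finset.sum_congr rfl fun a _ => Finset.sum_comm]
    refine Finset.sum_congr rfl fun a _ => Finset.sum_congr rfl fun i _ =>
      Finset.sum_congr rfl fun j _ => ?_
    rw [mul_assoc, cls_mul_comm]
  have h3 := sum_common_end U W Z
  simp only [Fintype.sum_prod_type, Fintype.sum_bool, arcEnd, endSign,
    ← Finset.sum_add_distrib] at h3
  rw [h1, h2, joinCut]
  simp only [← Finset.sum_add_distrib]
  rw [← neg_zero, ← h3]
  simp only [← Finset.sum_neg_distrib]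
  refine Finset.sum_congr rfl fun a _ => Finset.sum_congr rfl fun i _ =>
      Finset.sum_congr rfl fun j _ => ?_
  simp only [← add_smul, ← neg_smul]
  congr 1
  have := cyclic_sum_ordSign p hp (bar (U (a - 1))) (U a) (bar (W (i - 1))) (W i)
    (bar (Z (j - 1))) (Z j)
  simp only [crossAt, side]
  simp only at this
  linear_combination this

theorem loopBracket_jacobi (hp : Function.Injective p) (U : ZMod A → Letter n)
    (W : ZMod B → Letter n) (Z : ZMod C → Letter n) :
    loopBracket p (cls (full U 0)) (loopBracket p (cls (full W 0)) (cls (full Z 0))) +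
      loopBracket p (cls (full W 0)) (loopBracket p (cls (full Z 0)) (cls (full U 0))) +
      loopBracket p (cls (full Z 0)) (loopBracket p (cls (full U 0)) (cls (full W 0))) = 0 := by
  simp only [loopBracket_cls, loopBracket_loopBr]
  have h1 := joinCut_cyclic p hp U W Z
  have h2 := joinCut_cyclic p hp U Z W
  rw [doubleCut_symm p U W Z, doubleCut_symm p U Z W, doubleCut_symm p W U Z]
  have h3 : ∀ a b c d e f x y z : ConjClasses (FreeGroup (Fin n)) →₀ ℤ,
      a + b + c = 0 → d + e + f = 0 →
      a - d + x - y + (b - f + y - z) + (c - e + z - x) = 0 := by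
    intro a b c d e f x y z h h'
    calc _ = (a + b + c) - (d + e + f) := by abel
      _ = 0 := by rw [h, h', sub_zero]
  exact h3 _ _ _ _ _ _ _ _ _ h1 h2

end LoopBracket

/-! ### The cyclic order of the letters -/

section Orient

variable {n : ℕ}

/-- The position of a letter in the list `u`. -/
def pos (u : List (Letter n)) (x : Letter n) : ℤ := u.idxOf x

variable {u : List (Letter n)}

theorem pos_injective (hu : ∀ x, x ∈ u) : Function.Injective (pos u) := fun x y h =>
  (List.idxOf_inj (hu x)).1 (by simpa [pos] using h)

theorem sublist_iff_pairwise_pos (hn : u.Nodup) (hu : ∀ x, x ∈ u) (v : List (Letter n)) :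
    v.Sublist u ↔ v.Pairwise (fun x y => pos u x < pos u y) := by
  have hu' : u.Pairwise (fun x y => pos u x < pos u y) := by
    rw [List.pairwise_iff_getElem]
    intro i j hi hj hij
    simp only [pos, hn.idxOf_getElem]
    exact_mod_cast hij
  refine ⟨fun h => hu'.sublist h, fun h => ?_⟩
  have hv : v.Nodup := h.imp fun {a b} hab he => by rw [he] at hab; exact lt_irrefl _ hab
  have : Std.Antisymm (fun x y : Letter n => pos u x < pos u y) :=
    ⟨fun a b h1 h2 => (lt_asymm h1 h2).elim⟩
  exact List.sublist_of_subperm_of_pairwise (List.subperm_of_subset hv fun x _ => hu x) h hu'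

theorem orientedIn_coe_iff (hn : u.Nodup) (hu : ∀ x, x ∈ u) (v : List (Letter n)) :
    OrientedIn (u : Cycle (Letter n)) (v : Cycle (Letter n)) ↔
      ∃ k ≤ v.length, (v.rotate k).Pairwise (fun x y => pos u x < pos u y) := by
  simp only [← sublist_iff_pairwise_pos hn hu]
  constructor
  · rintro ⟨w, u', hw, hu', hs⟩
    obtain ⟨k, hk, rfl⟩ := List.isRotated_iff_mod.1 (Cycle.coe_eq_coe.1 hu').symm
    rw [List.rotate_eq_drop_append_take hk, List.sublist_append_iff] at hs
    obtain ⟨w₁, w₂, rfl, h₁, h₂⟩ := hs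
    have h : (w₂ ++ w₁).Sublist u := by
      conv_rhs => rw [← List.take_append_drop k u]
      exact h₂.append h₁
    obtain ⟨j, hj, hj'⟩ := List.isRotated_iff_mod.1
      ((Cycle.coe_eq_coe.1 hw).symm.trans List.isRotated_append)
    exact ⟨j, hj, hj' ▸ h⟩
  · rintro ⟨k, -, hk⟩
    exact ⟨v.rotate k, u, Cycle.coe_eq_coe.2 (List.IsRotated.forall v k), rfl, hk⟩

theorem orientedIn_three (hn : u.Nodup) (hu : ∀ x, x ∈ u) (x y z : Letter n) :
    OrientedIn (u : Cycle (Letter n)) ([x, y, z] : List (Letter n)) ↔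
      (pos u x < pos u y ∧ pos u y < pos u z) ∨ (pos u y < pos u z ∧ pos u z < pos u x) ∨
        (pos u z < pos u x ∧ pos u x < pos u y) := by
  rw [orientedIn_coe_iff hn hu]
  constructor
  · rintro ⟨k, hk, h⟩
    simp only [List.length_cons, List.length_nil] at hk
    interval_cases k <;> simp at h <;> omega
  · rintro (h | h | h)
    · exact ⟨0, by simp, by simp; omega⟩
    · exact ⟨1, by simp, by simp; omega⟩
    · exact ⟨2, by simp, by simp; omega⟩

theorem orientedIn_four (hn : u.Nodup) (hu : ∀ x, x ∈ u) (x y z w : Letter n) :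
    OrientedIn (u : Cycle (Letter n)) ([x, y, z, w] : List (Letter n)) ↔
      (pos u x < pos u y ∧ pos u y < pos u z ∧ pos u z < pos u w) ∨
      (pos u y < pos u z ∧ pos u z < pos u w ∧ pos u w < pos u x) ∨
      (pos u z < pos u w ∧ pos u w < pos u x ∧ pos u x < pos u y) ∨
      (pos u w < pos u x ∧ pos u x < pos u y ∧ pos u y < pos u z) := by
  rw [orientedIn_coe_iff hn hu]
  constructor
  · rintro ⟨k, hk, h⟩
    simp only [List.length_cons, List.length_nil] at hk
    interval_cases k <;> simp at h <;> omega
  · rintro (h | h | h | h)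
    · exact ⟨0, by simp, by simp; omega⟩
    · exact ⟨1, by simp, by simp; omega⟩
    · exact ⟨2, by simp, by simp; omega⟩
    · exact ⟨3, by simp, by simp; omega⟩

theorem orient_three (hn : u.Nodup) (hu : ∀ x, x ∈ u) (x y z : Letter n) :
    orient (u : Cycle (Letter n)) ([x, y, z] : List (Letter n)) =
      ordSign (pos u) x y + ordSign (pos u) y z + ordSign (pos u) z x := by
  have hr : ([x, y, z] : Cycle (Letter n)).reverse = ([z, y, x] : List (Letter n)) := rfl
  rw [orient, hr, orientedIn_three hn hu, orientedIn_three hn hu]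
  rcases ordSign_cases (pos u) x y with ⟨h1, e1⟩ | ⟨h1, e1⟩ | ⟨h1, e1⟩ <;>
  rcases ordSign_cases (pos u) y z with ⟨h2, e2⟩ | ⟨h2, e2⟩ | ⟨h2, e2⟩ <;>
  rcases ordSign_cases (pos u) z x with ⟨h3, e3⟩ | ⟨h3, e3⟩ | ⟨h3, e3⟩ <;>
  rw [e1, e2, e3] <;> split_ifs <;> omega

theorem orient_three_ne_zero (hn : u.Nodup) (hu : ∀ x, x ∈ u) {x y z : Letter n}
    (hxy : x ≠ y) (hyz : y ≠ z) (hzx : z ≠ x) :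
    orient (u : Cycle (Letter n)) ([x, y, z] : List (Letter n)) ≠ 0 := by
  rw [orient_three hn hu]
  have hxy := (pos_injective hu).ne hxy
  have hyz := (pos_injective hu).ne hyz
  have hzx := (pos_injective hu).ne hzx
  rcases ordSign_cases (pos u) x y with ⟨h1, e1⟩ | ⟨h1, e1⟩ | ⟨h1, e1⟩ <;>
  rcases ordSign_cases (pos u) y z with ⟨h2, e2⟩ | ⟨h2, e2⟩ | ⟨h2, e2⟩ <;>
  rcases ordSign_cases (pos u) z x with ⟨h3, e3⟩ | ⟨h3, e3⟩ | ⟨h3, e3⟩ <;> omega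

theorem orient_three_swap (hn : u.Nodup) (hu : ∀ x, x ∈ u) (x y z : Letter n) :
    orient (u : Cycle (Letter n)) ([x, z, y] : List (Letter n)) =
      -orient (u : Cycle (Letter n)) ([x, y, z] : List (Letter n)) := by
  rw [orient_three hn hu, orient_three hn hu, ordSign_swap _ z x, ordSign_swap _ y z,
    ordSign_swap _ x y]
  ring

theorem orient_eq_or (O : Cycle (Letter n)) (W : Cycle (Letter n)) :
    orient O W = 0 ∨ orient O W = 1 ∨ orient O W = -1 := by
  unfold orient
  split_ifs <;> simp

/-- For four distinct sides of the polygon, the sign of the cyclic word `c(acbd)` is the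
intersection number of the arcs `(a, b)` and `(c, d)`. -/
theorem two_mul_orient_four (hn : u.Nodup) (hu : ∀ x, x ∈ u) {a b c d : Letter n}
    (hab : a ≠ b) (hcd : c ≠ d) (hac : a ≠ c) (hbd : b ≠ d) (had : a ≠ d) (hbc : b ≠ c) :
    2 * orient (u : Cycle (Letter n)) ([a, c, b, d] : List (Letter n)) =
      ordSign (pos u) a c - ordSign (pos u) b c - (ordSign (pos u) a d - ordSign (pos u) b d) := by
  have hr : ([a, c, b, d] : Cycle (Letter n)).reverse = ([d, b, c, a] : List (Letter n)) := rfl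
  have hs : ∀ {x y : Letter n}, x ≠ y →
      ordSign (pos u) x y = if pos u x < pos u y then 1 else -1 := by
    intro x y hxy
    have hxy := (pos_injective hu).ne hxy
    rcases ordSign_cases (pos u) x y with ⟨h, e⟩ | ⟨h, e⟩ | ⟨h, e⟩ <;> rw [e] <;> split_ifs <;>
      omega
  rw [orient, hr, orientedIn_four hn hu, orientedIn_four hn hu, hs hac, hs hbc, hs had,
    hs hbd]
  have hab := (pos_injective hu).ne hab
  have hcd := (pos_injective hu).ne hcd
  have hac := (pos_injective hu).ne hac
  have hbd := (pos_injective hu).ne hbd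
  have had := (pos_injective hu).ne had
  have hbc := (pos_injective hu).ne hbc
  clear hs hr hn hu
  generalize pos u a = a' at *
  generalize pos u b = b' at *
  generalize pos u c = c' at *
  generalize pos u d = d' at *
  split_ifs <;> omega

theorem orient_four_eq_zero (hn : u.Nodup) (hu : ∀ x, x ∈ u) {a b c d : Letter n}
    (h : a = b ∨ c = d ∨ a = c ∨ b = d ∨ a = d ∨ b = c) :
    orient (u : Cycle (Letter n)) ([a, c, b, d] : List (Letter n)) = 0 := by
  have hr : ([a, c, b, d] : Cycle (Letter n)).reverse = ([d, b, c, a] : List (Letter n)) := rfl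
  rw [orient, hr, orientedIn_four hn hu, orientedIn_four hn hu]
  have h' : pos u a = pos u b ∨ pos u c = pos u d ∨ pos u a = pos u c ∨ pos u b = pos u d ∨
      pos u a = pos u d ∨ pos u b = pos u c := by
    simpa only [(pos_injective hu).eq_iff] using h
  split_ifs <;> omega

end Orient

/-! ### Maximal runs of a permutation inside a set -/

section Runs

variable {α : Type*} (T : Equiv.Perm α) (R : α → Prop)

/-- The pairs `(x, m)` such that the points `x, T x, …, T ^ (m - 1) x` form a maximal non-empty run
of points of the orbit of `x` that satisfy `R`. -/
def runs : Set (α × ℕ) :=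
  {y | 1 ≤ y.2 ∧ ¬ R (T⁻¹ y.1) ∧ (∀ t < y.2, R ((T ^ t) y.1)) ∧ ¬ R ((T ^ y.2) y.1)}

theorem runs_injOn : Set.InjOn Prod.fst (runs T R) := by
  rintro ⟨x, m⟩ h ⟨x', m'⟩ h' (rfl : x = x')
  have h1 : ¬ m < m' := fun hlt => h.2.2.2 (h'.2.2.1 m hlt)
  have h2 : ¬ m' < m := fun hlt => h'.2.2.2 (h.2.2.1 m' hlt)
  rw [show m = m' by omega]

theorem runs_finite [Finite α] : (runs T R).Finite :=
  Set.Finite.of_finite_image (Set.toFinite _) (runs_injOn T R)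

theorem runs_bijOn_start [Finite α] :
    Set.BijOn Prod.fst (runs T R) {x | R x ∧ ¬ R (T⁻¹ x)} := by
  refine ⟨fun y hy => ⟨by simpa using hy.2.2.1 0 hy.1, hy.2.1⟩, runs_injOn T R, ?_⟩
  rintro x ⟨hx, hx'⟩
  -- A run that never ends goes around the orbit of `x`, back to `T⁻¹ x`.
  have hex : ∃ m, ¬ R ((T ^ m) x) := by
    by_contra! hall
    have h := hall (orderOf T - 1)
    rw [← inv_eq_of_mul_eq_one_right (mul_pow_sub_one (orderOf_pos T).ne' T |>.trans
      (pow_orderOf_eq_one T))] at h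
    exact hx' h
  classical
  refine ⟨(x, Nat.find hex), ⟨?_, hx', fun t ht => not_not.1 (Nat.find_min hex ht),
    Nat.find_spec hex⟩, rfl⟩
  rw [Nat.one_le_iff_ne_zero]
  intro h0
  have := Nat.find_spec hex
  rw [show Nat.find hex = 0 from h0] at this
  exact this hx

theorem runs_bijOn_inv :
    Set.BijOn (fun y : α × ℕ => ((T ^ y.2) y.1, y.2)) (runs T R)
      (runs T⁻¹ fun x => R (T⁻¹ x)) := by
  have key : ∀ (T : Equiv.Perm α) (x : α) (m t : ℕ), t < m →
      T⁻¹ ((T⁻¹ ^ t) ((T ^ m) x)) = (T ^ (m - 1 - t)) x := by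
    intro T x m t ht
    rw [← Equiv.Perm.mul_apply, ← pow_succ', ← Equiv.Perm.mul_apply, inv_pow]
    congr 1
    rw [inv_mul_eq_iff_eq_mul, ← pow_add]
    congr 1
    omega
  refine Set.InvOn.bijOn (f' := fun y : α × ℕ => ((T⁻¹ ^ y.2) y.1, y.2)) ⟨?_, ?_⟩ ?_ ?_
  · rintro ⟨x, m⟩ -
    simp
  · rintro ⟨x, m⟩ -
    simp
  · rintro ⟨x, m⟩ ⟨h1, h2, h3, h4⟩
    refine ⟨h1, by simpa using h4, fun t ht => ?_, ?_⟩
    · simp only at ht ⊢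
      rw [key T x m t ht]
      exact h3 _ (by omega)
    · simpa using h2
  · rintro ⟨x, m⟩ ⟨h1, h2, h3, h4⟩
    refine ⟨h1, ?_, fun t ht => ?_, by simpa using h2⟩
    · simpa using h4
    · have := h3 (m - 1 - t) (by simp only at ht ⊢; omega)
      simp only at ht this ⊢
      have hk := key T ((T⁻¹ ^ m) x) m (m - 1 - t) (by omega)
      rw [show m - 1 - (m - 1 - t) = t by omega] at hk
      rw [← hk]
      simpa using this

theorem runs_bijOn_end [Finite α] :
    Set.BijOn (fun y : α × ℕ => (T ^ y.2) y.1) (runs T R) {x | ¬ R x ∧ R (T⁻¹ x)} := by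
  have h := (runs_bijOn_start T⁻¹ fun x => R (T⁻¹ x)).comp (runs_bijOn_inv T R)
  have h2 : {x | ¬ R x ∧ R (T⁻¹ x)} = {x | R (T⁻¹ x) ∧ ¬ R (T⁻¹ (T⁻¹⁻¹ x))} := by
    ext x; simp [and_comm]
  rw [h2]
  exact h

variable {T R} in
theorem apply_run_end {β : Type*} {G : α → β} (hG : ∀ x, R x → G (T x) = G x) {y : α × ℕ}
    (hy : y ∈ runs T R) : G ((T ^ y.2) y.1) = G y.1 := by
  have h : ∀ m x, (∀ t < m, R ((T ^ t) x)) → G ((T ^ m) x) = G x := by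
    intro m x
    induction m with
    | zero => simp
    | succ m ih =>
      intro h
      rw [pow_succ', Equiv.Perm.mul_apply, hG _ (h m (by omega)), ih fun t ht => h t (by omega)]
  exact h _ _ hy.2.2.1

end Runs

/-! ### Sums over the ends of runs -/

section RunSum

variable {α M : Type*} [Fintype α] [AddCommGroup M] (T : Equiv.Perm α) (R : α → Prop)

theorem finsum_mem_setOf_eq_sum_ite (S : α → Prop) [DecidablePred S] (f : α → M) :
    ∑ᶠ x ∈ {x | S x}, f x = ∑ x, if S x then f x else 0 := by
  rw [finsum_mem_def, finsum_eq_sum_of_fintype]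
  refine Finset.sum_congr rfl fun x _ => ?_
  rw [Set.indicator_apply]
  congr

open Classical in
/-- If the coefficients at the two ends of every maximal run are signs, then the contributions of
the two ends either cancel or agree. -/
theorem sum_run_ends (c : α → ℤ) (G : α → M) (hG : ∀ x, R x → G (T x) = G x)
    (hstart : ∀ x, R x → ¬ R (T⁻¹ x) → c x = 1 ∨ c x = -1)
    (hend : ∀ x, ¬ R x → R (T⁻¹ x) → c x = 1 ∨ c x = -1) :
    (∑ x, if R x ∧ ¬ R (T⁻¹ x) then c x • G x else 0) +
      (∑ x, if ¬ R x ∧ R (T⁻¹ x) then c x • G x else 0) =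
    (2 : ℤ) • ∑ᶠ y ∈ {y | y ∈ runs T R ∧ c y.1 = c ((T ^ y.2) y.1)}, c y.1 • G y.1 := by
  have hfin := runs_finite T R
  rw [← finsum_mem_setOf_eq_sum_ite, ← finsum_mem_setOf_eq_sum_ite,
    ← finsum_mem_eq_of_bijOn (f := fun y : α × ℕ => c y.1 • G y.1) Prod.fst
      (runs_bijOn_start T R) fun _ _ => rfl,
    ← finsum_mem_eq_of_bijOn (f := fun y : α × ℕ => c ((T ^ y.2) y.1) • G y.1)
      (fun y : α × ℕ => (T ^ y.2) y.1) (runs_bijOn_end T R) fun y hy => by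
        rw [apply_run_end hG hy],
    ← finsum_mem_add_distrib hfin, smul_finsum_mem (hfin.subset fun y hy => hy.1)]
  rw [finsum_mem_def, finsum_mem_def]
  refine finsum_congr fun y => ?_
  simp only [Set.indicator_apply, Set.mem_ofPred_eq]
  by_cases hy : y ∈ runs T R
  · have h1 := hstart y.1 (by simpa using hy.2.2.1 0 hy.1) hy.2.1
    have h2 := hend ((T ^ y.2) y.1) hy.2.2.2 ((runs_bijOn_end T R).mapsTo hy).2
    by_cases he : c y.1 = c ((T ^ y.2) y.1)
    · rw [if_pos hy, if_pos ⟨hy, he⟩, ← he, two_smul]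
    · rw [if_pos hy, if_neg fun h => he h.2, ← add_smul,
        show c y.1 + c ((T ^ y.2) y.1) = 0 by omega, zero_smul]
  · rw [if_neg hy, if_neg fun h => hy h.1]

end RunSum

/-! ### Pairs of positions of two reduced closed words -/

section Positions

variable {n B C : ℕ}

/-- The two arcs move on along the same letter. -/
def parallel (B C : ℕ) : Equiv.Perm (ZMod B × ZMod C) where
  toFun x := (x.1 + 1, x.2 + 1)
  invFun x := (x.1 - 1, x.2 - 1)
  left_inv x := by simp
  right_inv x := by simp

/-- The first arc moves on along a letter along which the second arc moves back. -/
def antiparallel (B C : ℕ) : Equiv.Perm (ZMod B × ZMod C) where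
  toFun x := (x.1 + 1, x.2 - 1)
  invFun x := (x.1 - 1, x.2 + 1)
  left_inv x := by simp
  right_inv x := by simp

theorem parallel_inv (x : ZMod B × ZMod C) : (parallel B C)⁻¹ x = (x.1 - 1, x.2 - 1) := rfl

theorem antiparallel_inv (x : ZMod B × ZMod C) : (antiparallel B C)⁻¹ x = (x.1 - 1, x.2 + 1) := rfl

theorem parallel_pow (m : ℕ) (x : ZMod B × ZMod C) :
    (parallel B C ^ m) x = (x.1 + m, x.2 + m) := by
  induction m with
  | zero => simp
  | succ m ih =>
    rw [pow_succ', Equiv.Perm.mul_apply, ih]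
    simp [parallel, add_assoc]

theorem antiparallel_pow (m : ℕ) (x : ZMod B × ZMod C) :
    (antiparallel B C ^ m) x = (x.1 + m, x.2 - m) := by
  induction m with
  | zero => simp
  | succ m ih =>
    rw [pow_succ', Equiv.Perm.mul_apply, ih]
    simp [antiparallel, add_assoc, sub_sub]

/-- No two cyclically adjacent letters of the closed word cancel. -/
def IsReducedClosed (W : ZMod B → Letter n) : Prop := ∀ i, W i ≠ bar (W (i + 1))

variable {W : ZMod B → Letter n} {Z : ZMod C → Letter n}

theorem IsReducedClosed.ne_pred (hW : IsReducedClosed W) (i : ZMod B) : bar (W (i - 1)) ≠ W i := by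
  intro h
  have := hW (i - 1)
  rw [sub_add_cancel, ← h, bar_bar] at this
  exact this rfl

variable (W Z) in
/-- The two arcs leave through the same side. -/
def SameExit (x : ZMod B × ZMod C) : Prop := W x.1 = Z x.2

variable (W Z) in
/-- The first arc leaves through the side through which the second one comes in. -/
def OppositeExit (x : ZMod B × ZMod C) : Prop := W x.1 = bar (Z (x.2 - 1))

theorem sameExit_inv (x : ZMod B × ZMod C) :
    SameExit W Z ((parallel B C)⁻¹ x) ↔ bar (W (x.1 - 1)) = bar (Z (x.2 - 1)) := by
  rw [parallel_inv, SameExit, bar_injective.eq_iff]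

theorem oppositeExit_inv (x : ZMod B × ZMod C) :
    OppositeExit W Z ((antiparallel B C)⁻¹ x) ↔ bar (W (x.1 - 1)) = Z x.2 := by
  rw [antiparallel_inv, OppositeExit, ← bar_injective.eq_iff, bar_bar, add_sub_cancel_right]

variable (W Z) in
/-- The class of the product of the loops cut at the given positions. -/
noncomputable def joined (x : ZMod B × ZMod C) : ConjClasses (FreeGroup (Fin n)) →₀ ℤ :=
  cls (full W x.1 * full Z x.2)

theorem joined_parallel (x : ZMod B × ZMod C) (h : SameExit W Z x) :
    joined W Z (parallel B C x) = joined W Z x := by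
  have h1 := seg_conj_full W x.1 1
  have h2 := seg_conj_full Z x.2 1
  rw [seg_one, Nat.cast_one] at h1 h2
  rw [← show W x.1 = Z x.2 from h] at h2
  rw [joined, joined, ← cls_conj (full W x.1 * full Z x.2) (letterElt (W x.1))]
  simp only [parallel, Equiv.coe_fn_mk, ← h1, ← h2]
  congr 1
  group

theorem joined_antiparallel (x : ZMod B × ZMod C) (h : OppositeExit W Z x) :
    joined W Z (antiparallel B C x) = joined W Z x := by
  have h1 := seg_conj_full W x.1 1
  have h2 := seg_conj_full Z (x.2 - 1) 1
  rw [seg_one, Nat.cast_one] at h1 h2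
  rw [sub_add_cancel] at h2
  have h3 := letterElt_bar (Z (x.2 - 1))
  rw [← show W x.1 = _ from h] at h3
  rw [joined, joined, ← cls_conj (full W x.1 * full Z x.2) (letterElt (W x.1))]
  simp only [antiparallel, Equiv.coe_fn_mk, ← h1, ← h2, h3]
  congr 1
  group

variable {u : List (Letter n)}

theorem crossAt_of_sameExit (hn : u.Nodup) (hu : ∀ x, x ∈ u) (x : ZMod B × ZMod C)
    (h : SameExit W Z x) : crossAt (pos u) W x.1 Z x.2 =
      orient (u : Cycle (Letter n)) ([bar (W (x.1 - 1)), bar (Z (x.2 - 1)), W x.1] :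
        List (Letter n)) := by
  rw [orient_three hn hu, crossAt, side, side, ← show W x.1 = Z x.2 from h,
    ordSign_swap _ (bar (Z (x.2 - 1))) (W x.1), ordSign_swap _ (bar (W (x.1 - 1))) (W x.1),
    ordSign, ordSign, ordSign, ordSign, sub_self, Int.sign_zero]
  ring

theorem crossAt_of_sameEntry (hn : u.Nodup) (hu : ∀ x, x ∈ u) (x : ZMod B × ZMod C)
    (h : bar (W (x.1 - 1)) = bar (Z (x.2 - 1))) : crossAt (pos u) W x.1 Z x.2 =
      orient (u : Cycle (Letter n)) ([W x.1, Z x.2, bar (W (x.1 - 1))] : List (Letter n)) := by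
  rw [orient_three hn hu, crossAt, side, side, ← h,
    ordSign_swap _ (bar (W (x.1 - 1))) (Z x.2), ordSign_swap _ (bar (W (x.1 - 1))) (W x.1),
    ordSign, ordSign, ordSign, ordSign, sub_self, Int.sign_zero]
  ring

theorem crossAt_of_oppositeExit (hn : u.Nodup) (hu : ∀ x, x ∈ u) (x : ZMod B × ZMod C)
    (h : OppositeExit W Z x) : crossAt (pos u) W x.1 Z x.2 =
      orient (u : Cycle (Letter n)) ([Z x.2, bar (W (x.1 - 1)), W x.1] : List (Letter n)) := by
  rw [orient_three hn hu, crossAt, side, side, ← show W x.1 = _ from h,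
    ordSign_swap _ (bar (W (x.1 - 1))) (Z x.2),
    ordSign, ordSign, ordSign, ordSign, sub_self, Int.sign_zero]
  ring

theorem crossAt_of_oppositeEntry (hn : u.Nodup) (hu : ∀ x, x ∈ u) (x : ZMod B × ZMod C)
    (h : bar (W (x.1 - 1)) = Z x.2) : crossAt (pos u) W x.1 Z x.2 =
      orient (u : Cycle (Letter n)) ([bar (Z (x.2 - 1)), W x.1, bar (W (x.1 - 1))] :
        List (Letter n)) := by
  rw [orient_three hn hu, crossAt, side, side, ← h,
    ordSign_swap _ (bar (Z (x.2 - 1))) (W x.1),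
    ordSign_swap _ (bar (W (x.1 - 1))) (W x.1),
    ordSign, ordSign, ordSign, ordSign, sub_self, Int.sign_zero]
  ring

theorem orient_three_eq_or (hn : u.Nodup) (hu : ∀ x, x ∈ u) {x y z : Letter n}
    (hxy : x ≠ y) (hyz : y ≠ z) (hzx : z ≠ x) :
    orient (u : Cycle (Letter n)) ([x, y, z] : List (Letter n)) = 1 ∨
      orient (u : Cycle (Letter n)) ([x, y, z] : List (Letter n)) = -1 :=
  (orient_eq_or _ _).resolve_left (orient_three_ne_zero hn hu hxy hyz hzx)

variable (W Z u) in
/-- The intersection number of the arcs at two positions if they have four distinct ends; `0`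
otherwise. -/
noncomputable def orientAt (x : ZMod B × ZMod C) : ℤ :=
  orient (u : Cycle (Letter n))
    ([bar (W (x.1 - 1)), bar (Z (x.2 - 1)), W x.1, Z x.2] : List (Letter n))

open Classical in
/-- The pairs of arcs that cross in earnest are those with four distinct ends and those at one end
of a run of common letters. Two arcs that share both ends do not cross. -/
theorem crossAt_decomp (hn : u.Nodup) (hu : ∀ x, x ∈ u) (hW : IsReducedClosed W)
    (hZ : IsReducedClosed Z) (x : ZMod B × ZMod C) :
    crossAt (pos u) W x.1 Z x.2 = 2 * orientAt W Z u x +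
      (if SameExit W Z x ∧ ¬ SameExit W Z ((parallel B C)⁻¹ x) then
        crossAt (pos u) W x.1 Z x.2 else 0) +
      (if ¬ SameExit W Z x ∧ SameExit W Z ((parallel B C)⁻¹ x) then
        crossAt (pos u) W x.1 Z x.2 else 0) +
      (if OppositeExit W Z x ∧ ¬ OppositeExit W Z ((antiparallel B C)⁻¹ x) then
        crossAt (pos u) W x.1 Z x.2 else 0) +
      (if ¬ OppositeExit W Z x ∧ OppositeExit W Z ((antiparallel B C)⁻¹ x) then
        crossAt (pos u) W x.1 Z x.2 else 0) := by
  have hab := hW.ne_pred x.1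
  have hcd := hZ.ne_pred x.2
  have c1 := crossAt_of_sameExit (W := W) (Z := Z) hn hu x
  have c3 := crossAt_of_oppositeExit (W := W) (Z := Z) hn hu x
  rw [orientAt]
  rw [sameExit_inv, oppositeExit_inv]
  rw [SameExit] at *
  rw [OppositeExit] at *
  have c0 : bar (W (x.1 - 1)) ≠ bar (Z (x.2 - 1)) → W x.1 ≠ Z x.2 → bar (W (x.1 - 1)) ≠ Z x.2 →
      W x.1 ≠ bar (Z (x.2 - 1)) → 2 * orient (u : Cycle (Letter n))
        ([bar (W (x.1 - 1)), bar (Z (x.2 - 1)), W x.1, Z x.2] : List (Letter n)) =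
        crossAt (pos u) W x.1 Z x.2 := fun h1 h2 h3 h4 =>
    two_mul_orient_four hn hu hab hcd h1 h2 h3 h4
  have c0' := orient_four_eq_zero (a := bar (W (x.1 - 1))) (b := W x.1) (c := bar (Z (x.2 - 1)))
    (d := Z x.2) hn hu
  have hz : ∀ y z : Letter n,
      orient (u : Cycle (Letter n)) ([y, y, z] : List (Letter n)) = 0 := by
    intro y z
    rw [orient_three hn hu, ordSign_swap _ y z, ordSign, sub_self, Int.sign_zero]
    ring
  have aux : ∀ (p₁ p₂ p₃ p₄ : Prop) (K o : ℤ), ¬ (p₂ ∧ p₄) → ¬ (p₂ ∧ p₃) → ¬ (p₁ ∧ p₄) →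
      ¬ (p₁ ∧ p₃) → (p₁ ∧ p₂ → K = 0) → (p₃ ∧ p₄ → K = 0) → (p₁ ∨ p₂ ∨ p₃ ∨ p₄ → o = 0) →
      (¬ p₁ → ¬ p₂ → ¬ p₃ → ¬ p₄ → 2 * o = K) →
      K = 2 * o + (if p₂ ∧ ¬ p₁ then K else 0) + (if ¬ p₂ ∧ p₁ then K else 0) +
        (if p₄ ∧ ¬ p₃ then K else 0) + (if ¬ p₄ ∧ p₃ then K else 0) := by
    intro p₁ p₂ p₃ p₄ K o
    by_cases h₁ : p₁ <;> by_cases h₂ : p₂ <;> by_cases h₃ : p₃ <;> by_cases h₄ : p₄ <;>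
      simp only [h₁, h₂, h₃, h₄] <;> simp <;> omega
  refine aux _ _ _ _ _ _ (fun h => hcd (h.2.symm.trans h.1)) (fun h => hab (h.2.trans h.1.symm))
    (fun h => hab (h.1.trans h.2.symm)) (fun h => hcd (h.1.symm.trans h.2)) (fun h => ?_)
    (fun h => ?_) (fun h => c0' (by tauto)) fun h1 h2 h3 h4 => c0 h1 h2 h3 h4
  · rw [c1 h.2, ← h.1, hz]
  · rw [c3 h.2, ← h.1, hz]

variable (W Z u) in
/-- The maximal runs of common letters at whose two ends the closed words cross to the same side. -/
def parallelRuns : Set ((ZMod B × ZMod C) × ℕ) :=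
  {y | y ∈ runs (parallel B C) (SameExit W Z) ∧ crossAt (pos u) W y.1.1 Z y.1.2 =
    crossAt (pos u) W ((parallel B C ^ y.2) y.1).1 Z ((parallel B C ^ y.2) y.1).2}

variable (W Z u) in
/-- The maximal runs of letters that the closed words traverse in opposite directions, and at whose
two ends they cross to the same side. -/
def antiparallelRuns : Set ((ZMod B × ZMod C) × ℕ) :=
  {y | y ∈ runs (antiparallel B C) (OppositeExit W Z) ∧ crossAt (pos u) W y.1.1 Z y.1.2 =
    crossAt (pos u) W ((antiparallel B C ^ y.2) y.1).1 Z ((antiparallel B C ^ y.2) y.1).2}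

open Classical in
theorem loopBr_full_eq_runs [NeZero B] [NeZero C] (hn : u.Nodup) (hu : ∀ x, x ∈ u)
    (hW : IsReducedClosed W) (hZ : IsReducedClosed Z) (i : ZMod B) (j : ZMod C) :
    loopBr (pos u) (full W i) (full Z j) =
      (2 : ℤ) • ((∑ x, orientAt W Z u x • joined W Z x) +
        (∑ᶠ y ∈ parallelRuns W Z u, crossAt (pos u) W y.1.1 Z y.1.2 • joined W Z y.1) +
        ∑ᶠ y ∈ antiparallelRuns W Z u, crossAt (pos u) W y.1.1 Z y.1.2 • joined W Z y.1) := by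
  have e2 := sum_run_ends (parallel B C) (SameExit W Z)
    (fun x => crossAt (pos u) W x.1 Z x.2) (joined W Z) joined_parallel ?_ ?_
  have e3 := sum_run_ends (antiparallel B C) (OppositeExit W Z)
    (fun x => crossAt (pos u) W x.1 Z x.2) (joined W Z) joined_antiparallel ?_ ?_
  · rw [smul_add, smul_add, parallelRuns, antiparallelRuns, ← e2, ← e3, Finset.smul_sum,
      loopBr_full, ← Fintype.sum_prod_type']
    simp only [← Finset.sum_add_distrib]
    refine Finset.sum_congr rfl fun x _ => ?_
    rw [← joined]
    conv_lhs => rw [crossAt_decomp hn hu hW hZ x]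
    simp only [add_smul, ite_smul, zero_smul, mul_smul, add_assoc]
  · intro x h1 h2
    rw [oppositeExit_inv] at h2
    rw [crossAt_of_oppositeExit hn hu x h1]
    exact orient_three_eq_or hn hu (Ne.symm h2) (hW.ne_pred _)
      (by rw [show W x.1 = _ from h1]; exact hZ.ne_pred _)
  · intro x h1 h2
    rw [oppositeExit_inv] at h2
    rw [crossAt_of_oppositeEntry hn hu x h2]
    exact orient_three_eq_or hn hu (Ne.symm h1) (hW.ne_pred _).symm
      (by rw [h2]; exact (hZ.ne_pred _).symm)
  · intro x h1 h2
    rw [sameExit_inv] at h2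
    rw [crossAt_of_sameExit hn hu x h1]
    exact orient_three_eq_or hn hu h2
      (by rw [show W x.1 = Z x.2 from h1]; exact hZ.ne_pred _) (hW.ne_pred _).symm
  · intro x h1 h2
    rw [sameExit_inv] at h2
    rw [crossAt_of_sameEntry hn hu x h2]
    exact orient_three_eq_or hn hu h1 (by rw [h2]; exact (hZ.ne_pred _).symm) (hW.ne_pred _)

end Positions

/-! ### Linked pairs as maximal runs -/

section Lists

variable {n : ℕ}

/-- The closed word of which `w` is a linear representative. -/
def closedWord (w : List (Letter n)) [NeZero w.length] : ZMod w.length → Letter n :=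
  fun i => w.get ⟨i.val, ZMod.val_lt i⟩

theorem subword_eq (w : List (Letter n)) [NeZero w.length] (i : Fin w.length) (m : ℕ)
    (t : Fin (m + 2)) :
    subword w i m t = closedWord w (((i : ℕ) : ZMod w.length) + ((t : ℕ) : ZMod w.length)) := by
  rw [subword, closedWord, ← Nat.cast_add]
  congr 2
  rw [ZMod.val_natCast]

theorem mk_ofFn {N : ℕ} (W : ZMod N → Letter n) (i : ZMod N) (d : ℕ) :
    FreeGroup.mk (List.ofFn fun t : Fin d => W (i + (t : ℕ))) = seg W i d := by
  induction d with
  | zero => simp [seg, FreeGroup.one_eq_mk]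
  | succ d ih =>
    rw [List.ofFn_succ_last, ← FreeGroup.mul_mk, seg, ← ih]
    rfl

theorem rotate_eq_ofFn (w : List (Letter n)) [NeZero w.length] (k : ℕ) :
    w.rotate k = List.ofFn fun t : Fin w.length =>
      closedWord w ((k : ZMod w.length) + ((t : ℕ) : ZMod w.length)) := by
  refine List.ext_getElem (by simp) fun t h1 h2 => ?_
  rw [List.getElem_rotate, List.getElem_ofFn, closedWord, ← Nat.cast_add]
  simp only [List.get_eq_getElem, ZMod.val_natCast, add_comm]

theorem mk_rotate (w : List (Letter n)) [NeZero w.length] (k : ℕ) :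
    FreeGroup.mk (w.rotate k) = full (closedWord w) k := by
  rw [rotate_eq_ofFn, mk_ofFn, full]

theorem reduced_rel_iff (a b : Letter n) : (a.1 = b.1 → a.2 = b.2) ↔ a ≠ bar b := by
  obtain ⟨a, s⟩ := a
  obtain ⟨b, t⟩ := b
  simp only [bar, ne_eq, Prod.mk.injEq, not_and]
  cases s <;> cases t <;> simp

theorem isReduced_iff (L : List (Letter n)) :
    FreeGroup.IsReduced L ↔ L.IsChain fun a b => a ≠ bar b := by
  simp only [FreeGroup.IsReduced, reduced_rel_iff]

theorem neZero_length {w : List (Letter n)} (hw : IsReducedCyclic (w : Cycle (Letter n))) :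
    NeZero w.length :=
  ⟨fun h => hw.1 (by rw [List.eq_nil_of_length_eq_zero h, Cycle.coe_nil])⟩

theorem isReducedClosed {w : List (Letter n)} [NeZero w.length]
    (hw : IsReducedCyclic (w : Cycle (Letter n))) : IsReducedClosed (closedWord w) := by
  intro i
  have h := hw.2 (w.rotate i.val) (Cycle.coe_eq_coe.2 (List.IsRotated.forall w _))
  rw [isReduced_iff, List.isChain_iff_getElem] at h
  rcases Nat.lt_or_ge 1 w.length with h1 | h1
  · have := h 0 (by simpa using h1)
    simp only [rotate_eq_ofFn, List.getElem_ofFn] at this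
    simpa using this
  · have h2 : w.length = 1 := le_antisymm h1 (Nat.pos_of_ne_zero (NeZero.ne _))
    have : Subsingleton (ZMod w.length) := by rw [h2]; infer_instance
    rw [Subsingleton.elim (i + 1) i]
    exact fun h => bar_ne _ h.symm

theorem isReducedWord_subword {w : List (Letter n)} [NeZero w.length]
    (hw : IsReducedClosed (closedWord w)) (i : Fin w.length) (m : ℕ) :
    IsReducedWord (subword w i m) := by
  intro t
  rw [subword_eq, subword_eq, Fin.val_castSucc, Fin.val_succ, Nat.cast_add, Nat.cast_one,
    ← add_assoc]
  exact hw _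

variable {w z : List (Letter n)} [NeZero w.length] [NeZero z.length] {u : List (Letter n)}

theorem subword_zero (i : Fin w.length) (m : ℕ) :
    subword w i m 0 = closedWord w ((i : ℕ) + 1 - 1) := by
  simp [subword_eq]

theorem subword_last (i : Fin w.length) (m : ℕ) :
    subword w i m (Fin.last _) = closedWord w ((i : ℕ) + 1 + m) := by
  rw [subword_eq, Fin.val_last, Nat.cast_add, Nat.cast_one, add_assoc, add_comm (1 : ZMod _)]

theorem subword_one (i : Fin w.length) (m : ℕ) :
    subword w i m 1 = closedWord w ((i : ℕ) + 1) := by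
  simp [subword_eq]

theorem subword_mid (i : Fin w.length) (m t : ℕ) (h : t + 1 < m + 2) :
    subword w i m ⟨t + 1, h⟩ = closedWord w ((i : ℕ) + 1 + t) := by
  rw [subword_eq, Nat.cast_add, Nat.cast_one, add_assoc, add_comm (1 : ZMod _)]

theorem subword_rev_one (i : Fin w.length) (m : ℕ) (hm : 1 ≤ m) :
    subword w i m (Fin.rev 1) = closedWord w ((i : ℕ) + 1 + m - 1) := by
  rw [subword_eq, Fin.val_rev, Fin.val_one, show m + 2 - (1 + 1) = m by omega]
  congr 1
  ring

theorem linked1_iff (i : Fin w.length) (j : Fin z.length) (m : ℕ) :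
    Linked1 (u : Cycle (Letter n)) (subword w i m) (subword z j m) ↔
      m = 0 ∧ orientAt (closedWord w) (closedWord z) u ((i : ℕ) + 1, (j : ℕ) + 1) ≠ 0 := by
  refine and_congr_right fun hm => ?_
  subst hm
  simp [subword_eq, orientAt]

/-- Reindexing of the inner letters of a word of length `m + 2`. -/
theorem subword_inner_iff (m : ℕ) (φ : Fin (m + 2) → Prop) :
    (∀ t, t ≠ 0 → t ≠ Fin.last _ → φ t) ↔ ∀ (t : ℕ) (h : t < m), φ ⟨t + 1, by omega⟩ := by
  constructor
  · intro h t ht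
    refine h _ ?_ ?_ <;> rw [Ne, Fin.ext_iff] <;> simp
    omega
  · intro h t h0 hl
    rw [Ne, Fin.ext_iff] at h0 hl
    simp only [Fin.val_zero, Fin.val_last] at h0 hl
    have := h (t - 1) (by omega)
    simpa [show (t : ℕ) - 1 + 1 = t by omega] using this

theorem linked2_iff (hn : u.Nodup) (hu : ∀ x, x ∈ u) (i : Fin w.length) (j : Fin z.length)
    (m : ℕ) :
    Linked2 (u : Cycle (Letter n)) (subword w i m) (subword z j m) ↔
      ((((i : ℕ) + 1 : ZMod w.length), ((j : ℕ) + 1 : ZMod z.length)), m) ∈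
        parallelRuns (closedWord w) (closedWord z) u := by
  rw [Linked2, subword_inner_iff, parallelRuns, runs]
  simp only [Set.mem_ofPred_eq, and_assoc, subword_zero, subword_last, subword_one, subword_mid,
    parallel_pow, parallel_inv, SameExit]
  refine and_congr_right fun hm => ?_
  rw [and_left_comm]
  refine and_congr_right fun h1 => and_congr_right fun h2 => and_congr_right fun h3 => ?_
  rw [subword_rev_one _ _ hm, crossAt_of_sameExit hn hu (_, _) (by simpa [SameExit] using h2 0 hm),
    crossAt_of_sameEntry hn hu (_ + (m : ZMod w.length), _ + (m : ZMod z.length))]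
  have := h2 (m - 1) (by omega)
  rw [Nat.cast_sub hm, Nat.cast_sub hm] at this
  simp only [bar_injective.eq_iff]
  convert this using 2 <;> push_cast <;> ring

theorem linked3_iff (hn : u.Nodup) (hu : ∀ x, x ∈ u) (i : Fin w.length) (j : Fin z.length)
    (m : ℕ) :
    Linked3 (u : Cycle (Letter n)) (subword w i m) (subword z j m) ↔
      ((((i : ℕ) + 1 : ZMod w.length), ((j : ℕ) + 1 + m : ZMod z.length)), m) ∈
        antiparallelRuns (closedWord w) (closedWord z) u := by
  rw [Linked3, subword_inner_iff, antiparallelRuns, runs]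
  simp only [Set.mem_ofPred_eq, and_assoc, subword_zero, subword_last, subword_one, subword_mid,
    antiparallel_pow, antiparallel_inv, OppositeExit, add_sub_cancel_right]
  refine and_congr_right fun hm => ?_
  have e1 : (∀ (t : ℕ) (h : t < m), closedWord w ((i : ℕ) + 1 + t) =
        bar (subword z j m (Fin.rev ⟨t + 1, by omega⟩))) ↔
      ∀ (t : ℕ), t < m → closedWord w ((i : ℕ) + 1 + t) =
        bar (closedWord z ((j : ℕ) + 1 + m - t - 1)) := by
    refine forall_congr' fun t => forall_congr' fun ht => ?_
    rw [subword_eq, Fin.val_rev, show m + 2 - (t + 1 + 1) = m - t by omega, Nat.cast_sub ht.le,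
      show ((j : ℕ) : ZMod z.length) + 1 + m - t - 1 = j + (m - t) by ring]
  rw [e1, and_left_comm]
  refine and_congr_right fun h1 => and_congr_right fun h2 => and_congr_right fun h3 => ?_
  rw [subword_rev_one _ _ hm,
    crossAt_of_oppositeExit hn hu (_, _) (by simpa [OppositeExit] using h2 0 hm),
    crossAt_of_oppositeEntry hn hu (_ + (m : ZMod w.length), ((j : ℕ) + 1 : ZMod z.length))]
  · simp only [add_sub_cancel_right]
  · have := h2 (m - 1) (by omega)
    rw [Nat.cast_sub hm, Nat.cast_sub hm] at this
    rw [← bar_injective.eq_iff, bar_bar]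
    convert this using 2 <;> push_cast <;> ring_nf

end Lists

/-! ### The sum over the linked pairs -/

section LinkedPairs

variable {n : ℕ}

/-- The conjugacy class of the free group represented by a cyclic word, as an element of the free
module on the conjugacy classes. -/
noncomputable def cycleCls (C : Cycle (Letter n)) : ConjClasses (FreeGroup (Fin n)) →₀ ℤ :=
  Quotient.liftOn C (fun l => cls (FreeGroup.mk l)) fun l l' h => by
    obtain ⟨k, rfl⟩ := h
    rcases Nat.eq_zero_or_pos l.length with h0 | h0
    · rw [List.eq_nil_of_length_eq_zero h0, List.rotate_nil]
    · conv_lhs => rw [← List.take_append_drop (k % l.length) l]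
      rw [← List.rotate_mod, List.rotate_eq_drop_append_take (Nat.mod_lt _ h0).le,
        ← FreeGroup.mul_mk, ← FreeGroup.mul_mk, cls_mul_comm]

theorem cycleCls_coe (l : List (Letter n)) :
    cycleCls (l : Cycle (Letter n)) = cls (FreeGroup.mk l) := rfl

theorem cls_reduceCyclically (l : List (Letter n)) :
    cls (FreeGroup.mk (FreeGroup.reduceCyclically (FreeGroup.reduce l))) =
      cls (FreeGroup.mk l) := by
  have h := FreeGroup.reduceCyclically.conj_conjugator_reduceCyclically (FreeGroup.reduce l)
  have h2 : FreeGroup.mk (FreeGroup.reduce l) = FreeGroup.mk l := FreeGroup.reduce.self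
  rw [← h2]
  conv_rhs => rw [← h]
  rw [← FreeGroup.mul_mk, ← FreeGroup.mul_mk, ← FreeGroup.inv_mk]
  exact (cls_eq_of_isConj (isConj_iff.2 ⟨_, rfl⟩))

variable {w z : List (Letter n)} [NeZero w.length] [NeZero z.length] {u : List (Letter n)}

variable (w) in
/-- The positions of the linear word `w` as positions of the closed word, moved by one letter. -/
def succPos : Fin w.length ≃ ZMod w.length where
  toFun i := (i : ℕ) + 1
  invFun x := ⟨(x - 1).val, ZMod.val_lt _⟩
  left_inv i := by
    ext
    simp [ZMod.val_natCast, Nat.mod_eq_of_lt i.2]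
  right_inv x := by simp

variable (w z) in
/-- A pair of occurrences of linear words of length `m + 2`, as the pair of the positions of the
arcs at the beginning of their common part, for the type `P = p₁Yp₂`, `Q = q₁Yq₂`. -/
def parallelStart : Fin w.length × Fin z.length × ℕ ≃ (ZMod w.length × ZMod z.length) × ℕ :=
  (Equiv.prodAssoc _ _ _).symm.trans
    (((succPos w).prodCongr (succPos z)).prodCongr (Equiv.refl ℕ))

variable (w z) in
/-- A pair of occurrences of linear words of length `m + 2`, as the pair of the positions of the
arcs where `Y` begins and `Ȳ` ends, for the type `P = p₁Yp₂`, `Q = q₁Ȳq₂`. -/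
def antiparallelStart : Fin w.length × Fin z.length × ℕ ≃ (ZMod w.length × ZMod z.length) × ℕ :=
  (parallelStart w z).trans
    { toFun := fun y => ((y.1.1, y.1.2 + y.2), y.2)
      invFun := fun y => ((y.1.1, y.1.2 - y.2), y.2)
      left_inv := fun y => by simp
      right_inv := fun y => by simp }

theorem parallelStart_apply (i : Fin w.length) (j : Fin z.length) (m : ℕ) :
    parallelStart w z (i, j, m) =
      ((((i : ℕ) : ZMod w.length) + 1, ((j : ℕ) : ZMod z.length) + 1), m) := rfl

theorem antiparallelStart_apply (i : Fin w.length) (j : Fin z.length) (m : ℕ) :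
    antiparallelStart w z (i, j, m) =
      ((((i : ℕ) : ZMod w.length) + 1, ((j : ℕ) : ZMod z.length) + 1 + (m : ZMod z.length)), m) :=
  rfl

/-- Linked pairs of the second type are not of the third type, since a non-empty reduced word is not
equal to its inverse. -/
theorem Linked2.not_linked3 {O : Cycle (Letter n)} {m : ℕ} {P Q : Fin (m + 2) → Letter n}
    (hP : IsReducedWord P) (h2 : Linked2 O P Q) : ¬ Linked3 O P Q := by
  intro h3
  have key : ∀ t : Fin (m + 2), t ≠ 0 → t ≠ Fin.last _ → P t = bar (P t.rev) := by
    intro t h0 hl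
    rw [h3.2.1 t h0 hl, h2.2.1 t.rev]
    · rwa [Ne, ← Fin.rev_last, Fin.rev_inj]
    · rwa [Ne, ← Fin.rev_zero, Fin.rev_inj]
  have hm := h2.1
  rcases Nat.even_or_odd' m with ⟨s, hs | hs⟩
  · have h := key ⟨s, by omega⟩ (by rw [Ne, Fin.ext_iff]; simp; omega)
      (by rw [Ne, Fin.ext_iff]; simp; omega)
    refine hP ⟨s, by omega⟩ (h.trans ?_)
    congr 2
    rw [Fin.ext_iff]
    simp
    omega
  · have h := key ⟨s + 1, by omega⟩ (by rw [Ne, Fin.ext_iff]; simp)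
      (by rw [Ne, Fin.ext_iff]; simp; omega)
    have h' : (⟨s + 1, by omega⟩ : Fin (m + 2)).rev = ⟨s + 1, by omega⟩ := by
      rw [Fin.ext_iff]
      simp
      omega
    rw [h'] at h
    exact bar_ne _ h.symm

theorem cycleCls_gamma_of_linked3 (x : Fin w.length × Fin z.length × ℕ) {O : Cycle (Letter n)}
    (h : Linked3 O (subword w x.1 x.2.2) (subword z x.2.1 x.2.2)) :
    cycleCls (gamma O w z x) = joined (closedWord w) (closedWord z)
      ((x.1 : ℕ) + 1 + x.2.2, (x.2.1 : ℕ) + 1) := by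
  rw [gamma, if_pos h, cycleCls_coe, cls_reduceCyclically, ← FreeGroup.mul_mk, mk_rotate,
    mk_rotate, joined]
  push_cast
  rw [add_right_comm]

theorem cycleCls_gamma_of_not_linked3 (x : Fin w.length × Fin z.length × ℕ) {O : Cycle (Letter n)}
    (h : ¬ Linked3 O (subword w x.1 x.2.2) (subword z x.2.1 x.2.2)) :
    cycleCls (gamma O w z x) = joined (closedWord w) (closedWord z)
      ((x.1 : ℕ) + 1 + x.2.2, (x.2.1 : ℕ) + 1 + x.2.2) := by
  rw [gamma, if_neg h, cycleCls_coe, ← FreeGroup.mul_mk, mk_rotate, mk_rotate, joined]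
  push_cast
  rw [add_right_comm, add_right_comm ((x.2.1 : ℕ) : ZMod z.length)]

theorem LP_eq_union {O : Cycle (Letter n)} (hW : IsReducedClosed (closedWord w))
    (hZ : IsReducedClosed (closedWord z)) :
    LP O w z = {x | Linked1 O (subword w x.1 x.2.2) (subword z x.2.1 x.2.2)} ∪
      ({x | Linked2 O (subword w x.1 x.2.2) (subword z x.2.1 x.2.2)} ∪
        {x | Linked3 O (subword w x.1 x.2.2) (subword z x.2.1 x.2.2)}) := by
  ext x
  simp only [LP, Linked, isReducedWord_subword hW, isReducedWord_subword hZ, true_and,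
    Set.mem_union, Set.mem_ofPred_eq]

theorem bijOn_linked1 : Set.BijOn (parallelStart w z)
    {x | Linked1 (u : Cycle (Letter n)) (subword w x.1 x.2.2) (subword z x.2.1 x.2.2)}
    {y | y.2 = 0 ∧ orientAt (closedWord w) (closedWord z) u y.1 ≠ 0} :=
  Equiv.bijOn _ fun x => (linked1_iff x.1 x.2.1 x.2.2).symm

theorem bijOn_linked2 (hn : u.Nodup) (hu : ∀ x, x ∈ u) : Set.BijOn (parallelStart w z)
    {x | Linked2 (u : Cycle (Letter n)) (subword w x.1 x.2.2) (subword z x.2.1 x.2.2)}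
    (parallelRuns (closedWord w) (closedWord z) u) :=
  Equiv.bijOn _ fun x => (linked2_iff hn hu x.1 x.2.1 x.2.2).symm

theorem bijOn_linked3 (hn : u.Nodup) (hu : ∀ x, x ∈ u) : Set.BijOn (antiparallelStart w z)
    {x | Linked3 (u : Cycle (Letter n)) (subword w x.1 x.2.2) (subword z x.2.1 x.2.2)}
    (antiparallelRuns (closedWord w) (closedWord z) u) :=
  Equiv.bijOn _ fun x => (linked3_iff hn hu x.1 x.2.1 x.2.2).symm

theorem finite_linked1 :
    {x : Fin w.length × Fin z.length × ℕ |
      Linked1 (u : Cycle (Letter n)) (subword w x.1 x.2.2) (subword z x.2.1 x.2.2)}.Finite :=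
  bijOn_linked1.finite_iff_finite.2 <|
    ((Set.finite_univ (α := ZMod w.length × ZMod z.length)).prod (Set.finite_singleton 0)).subset
      fun _ hy => ⟨trivial, hy.1⟩

theorem finite_linked2 (hn : u.Nodup) (hu : ∀ x, x ∈ u) :
    {x : Fin w.length × Fin z.length × ℕ |
      Linked2 (u : Cycle (Letter n)) (subword w x.1 x.2.2) (subword z x.2.1 x.2.2)}.Finite :=
  (bijOn_linked2 hn hu).finite_iff_finite.2 ((runs_finite _ _).subset fun _ hy => hy.1)

theorem finite_linked3 (hn : u.Nodup) (hu : ∀ x, x ∈ u) :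
    {x : Fin w.length × Fin z.length × ℕ |
      Linked3 (u : Cycle (Letter n)) (subword w x.1 x.2.2) (subword z x.2.1 x.2.2)}.Finite :=
  (bijOn_linked3 hn hu).finite_iff_finite.2 ((runs_finite _ _).subset fun _ hy => hy.1)

theorem LP_finite (hn : u.Nodup) (hu : ∀ x, x ∈ u) (hW : IsReducedClosed (closedWord w))
    (hZ : IsReducedClosed (closedWord z)) : (LP (u : Cycle (Letter n)) w z).Finite := by
  rw [LP_eq_union hW hZ]
  exact finite_linked1.union ((finite_linked2 hn hu).union (finite_linked3 hn hu))

/-- The sum over the linked pairs is the Goldman bracket. -/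
theorem two_smul_sum_LP (hn : u.Nodup) (hu : ∀ x, x ∈ u) (hW : IsReducedClosed (closedWord w))
    (hZ : IsReducedClosed (closedWord z)) :
    (2 : ℤ) • ∑ᶠ x ∈ LP (u : Cycle (Letter n)) w z,
        signLP (u : Cycle (Letter n)) w z x • cycleCls (gamma (u : Cycle (Letter n)) w z x) =
      loopBr (pos u) (FreeGroup.mk w) (FreeGroup.mk z) := by
  have hw : FreeGroup.mk w = full (closedWord w) 0 := by
    simpa using mk_rotate w 0
  have hz : FreeGroup.mk z = full (closedWord z) 0 := by
    simpa using mk_rotate z 0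
  rw [hw, hz, loopBr_full_eq_runs hn hu hW hZ, LP_eq_union hW hZ,
    finsum_mem_union ?_ finite_linked1 ((finite_linked2 hn hu).union (finite_linked3 hn hu)),
    finsum_mem_union ?_ (finite_linked2 hn hu) (finite_linked3 hn hu), ← add_assoc]
  · refine congrArg _ (congrArg₂ _ (congrArg₂ _ ?_ ?_) ?_)
    · have hb : Set.BijOn Prod.fst
          {y : (ZMod w.length × ZMod z.length) × ℕ |
            y.2 = 0 ∧ orientAt (closedWord w) (closedWord z) u y.1 ≠ 0}
          {x | orientAt (closedWord w) (closedWord z) u x ≠ 0} := by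
        refine ⟨fun y hy => hy.2, ?_, fun x hx => ⟨(x, 0), ⟨rfl, hx⟩, rfl⟩⟩
        rintro ⟨x, m⟩ hx ⟨y, m'⟩ hy hxy
        exact Prod.ext hxy (hx.1.trans hy.1.symm)
      rw [finsum_mem_eq_of_bijOn (g := fun x => orientAt (closedWord w) (closedWord z) u x •
        joined (closedWord w) (closedWord z) x) _ (hb.comp (bijOn_linked1 (w := w) (z := z)))]
      · classical
        rw [finsum_mem_setOf_eq_sum_ite]
        refine Finset.sum_congr rfl fun x _ => ?_
        split_ifs with h
        · rfl
        · rw [not_not.1 h, zero_smul]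
      · rintro ⟨i, j, m⟩ hx
        have hl : Linked1 (u : Cycle (Letter n)) (subword w i m) (subword z j m) := hx
        have h3 : ¬ Linked3 (u : Cycle (Letter n)) (subword w i m) (subword z j m) := fun h => by
          have := h.1
          have := hl.1
          omega
        have hs : signLP (u : Cycle (Letter n)) w z (i, j, m) =
            orientAt (closedWord w) (closedWord z) u ((i : ℕ) + 1, (j : ℕ) + 1) := by
          obtain rfl : m = 0 := hl.1
          rw [signLP, sign, if_pos hl]
          simp [subword_eq, orientAt]
        rw [hs, cycleCls_gamma_of_not_linked3 _ h3]
        obtain rfl : m = 0 := hx.1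
        simp [parallelStart_apply]
    · refine finsum_mem_eq_of_bijOn _ (bijOn_linked2 hn hu) ?_
      rintro ⟨i, j, m⟩ hx
      have hl : Linked2 (u : Cycle (Letter n)) (subword w i m) (subword z j m) := hx
      have hr := (bijOn_linked2 hn hu).mapsTo hx
      have h1 : ¬ Linked1 (u : Cycle (Letter n)) (subword w i m) (subword z j m) := fun h => by
        have := h.1
        have := hl.1
        omega
      have hs : signLP (u : Cycle (Letter n)) w z (i, j, m) =
          crossAt (pos u) (closedWord w) ((i : ℕ) + 1) (closedWord z) ((j : ℕ) + 1) := by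
        rw [signLP, sign, if_neg h1, if_pos hl,
          crossAt_of_sameExit hn hu (((i : ℕ) + 1 : ZMod w.length), ((j : ℕ) + 1 : ZMod z.length))
          (hr.1.2.2.1 0 hx.1), subword_zero, subword_zero, subword_one]
      rw [hs, cycleCls_gamma_of_not_linked3 _ (hx.not_linked3 (isReducedWord_subword hW _ _))]
      have he := apply_run_end joined_parallel hr.1
      rw [parallelStart_apply] at he ⊢
      rw [← he, parallel_pow]
    · refine finsum_mem_eq_of_bijOn _ (bijOn_linked3 hn hu) ?_
      rintro ⟨i, j, m⟩ hx
      have hl : Linked3 (u : Cycle (Letter n)) (subword w i m) (subword z j m) := hx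
      have hr := (bijOn_linked3 hn hu).mapsTo hx
      have h1 : ¬ Linked1 (u : Cycle (Letter n)) (subword w i m) (subword z j m) := fun h => by
        have := h.1
        have := hl.1
        omega
      have h2 : ¬ Linked2 (u : Cycle (Letter n)) (subword w i m) (subword z j m) := fun h =>
        h.not_linked3 (isReducedWord_subword hW _ _) hx
      have hs : signLP (u : Cycle (Letter n)) w z (i, j, m) =
          crossAt (pos u) (closedWord w) ((i : ℕ) + 1) (closedWord z) ((j : ℕ) + 1 + m) := by
        rw [signLP, sign, if_neg h1, if_neg h2, if_pos hl,
          crossAt_of_oppositeExit hn hu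
            (((i : ℕ) + 1 : ZMod w.length), ((j : ℕ) + 1 + m : ZMod z.length))
            (hr.1.2.2.1 0 hx.1), subword_zero, subword_last, subword_one]
      rw [hs, cycleCls_gamma_of_linked3 _ hx]
      have he := apply_run_end joined_antiparallel hr.1
      rw [antiparallelStart_apply] at he ⊢
      rw [← he, antiparallel_pow]
      simp only [add_sub_cancel_right]
  · rw [Set.disjoint_left]
    intro x h2 h3
    exact h2.not_linked3 (isReducedWord_subword hW _ _) h3
  · rw [Set.disjoint_left]
    rintro x h1 (h2 | h3)
    · have := h2.1
      have := h1.1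
      omega
    · have := h3.1
      have := h1.1
      omega

end LinkedPairs

/-! ### The products `γ(P, Q)` are reduced -/

section Gamma

variable {n : ℕ}

theorem isCyclicallyReduced_iff' (L : List (Letter n)) : FreeGroup.IsCyclicallyReduced L ↔
    FreeGroup.IsReduced L ∧ ∀ a ∈ L.getLast?, ∀ b ∈ L.head?, a ≠ bar b := by
  simp only [FreeGroup.isCyclicallyReduced_iff, reduced_rel_iff]

theorem isReduced_append {L L' : List (Letter n)} (h : FreeGroup.IsReduced L)
    (h' : FreeGroup.IsReduced L') (hj : ∀ a ∈ L.getLast?, ∀ b ∈ L'.head?, a ≠ bar b) :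
    FreeGroup.IsReduced (L ++ L') := by
  rw [isReduced_iff] at *
  exact List.isChain_append.2 ⟨h, h', hj⟩

theorem isReducedCyclic_coe {L : List (Letter n)} (h0 : L ≠ [])
    (h : FreeGroup.IsCyclicallyReduced L) : IsReducedCyclic (L : Cycle (Letter n)) := by
  refine ⟨by rwa [Ne, Cycle.coe_eq_nil], fun w hw => ?_⟩
  obtain ⟨k, hk, rfl⟩ := List.isRotated_iff_mod.1 (Cycle.coe_eq_coe.1 hw).symm
  have h2 := (h.flatten_replicate 2).isReduced
  refine h2.infix ⟨L.take k, L.drop k, ?_⟩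
  rw [List.rotate_eq_drop_append_take hk]
  simp only [List.replicate, List.flatten_cons, List.flatten_nil, List.append_nil]
  rw [← List.append_assoc, List.take_append_drop, List.append_assoc, List.take_append_drop]

theorem reduceCyclically_eq_self {L : List (Letter n)} (h : FreeGroup.IsCyclicallyReduced L) :
    FreeGroup.reduceCyclically L = L := by
  induction L using List.bidirectionalRec with
  | nil => simp
  | singleton => simp
  | cons_append a l b _ =>
    rw [FreeGroup.reduceCyclically.cons_append, if_neg, List.cons_append]
    rintro ⟨h1, h2⟩
    have := (FreeGroup.isCyclicallyReduced_cons_append_iff.1 (by simpa using h)).2 h1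
    rw [this] at h2
    simp at h2

theorem mk_ne_one {L : List (Letter n)} (h0 : L ≠ []) (h : FreeGroup.IsReduced L) :
    FreeGroup.mk L ≠ 1 := by
  intro h1
  rw [FreeGroup.one_eq_mk] at h1
  have := FreeGroup.reduce.sound h1
  rw [h.reduce_eq, FreeGroup.reduce_nil] at this
  exact h0 this

theorem cls_injective_one {g : FreeGroup (Fin n)} (h : cls g = cls 1) : g = 1 := by
  have h1 := Finsupp.single_left_injective (one_ne_zero (α := ℤ)) h
  exact isConj_one_left.1 (ConjClasses.mk_eq_mk_iff_isConj.1 h1)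

theorem isReduced_reduce (L : List (Letter n)) : FreeGroup.IsReduced (FreeGroup.reduce L) :=
  FreeGroup.IsReduced.of_reduce_eq FreeGroup.reduce.idem

/-- The linear word formed by `d` consecutive letters of the closed word `W`, from position `i`
on. -/
def window {N : ℕ} (W : ZMod N → Letter n) (i : ZMod N) (d : ℕ) : List (Letter n) :=
  List.ofFn fun t : Fin d => W (i + (t : ℕ))

section Window

variable {N : ℕ} {W : ZMod N → Letter n}

theorem mk_window (i : ZMod N) (d : ℕ) : FreeGroup.mk (window W i d) = seg W i d := mk_ofFn W i d

theorem length_window (i : ZMod N) (d : ℕ) : (window W i d).length = d := by simp [window]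

theorem window_add (i : ZMod N) (d d' : ℕ) :
    window W i (d + d') = window W i d ++ window W (i + d) d' := by
  rw [window, List.ofFn_add, window, window]
  simp [add_assoc]

theorem isReduced_window (hW : IsReducedClosed W) (i : ZMod N) (d : ℕ) :
    FreeGroup.IsReduced (window W i d) := by
  rw [isReduced_iff, List.isChain_iff_getElem]
  intro t ht
  simp only [window, List.getElem_ofFn]
  rw [Nat.cast_add, Nat.cast_one, ← add_assoc]
  exact hW _

theorem head?_window {i : ZMod N} {d : ℕ} {a : Letter n} (h : a ∈ (window W i d).head?) :
    0 < d ∧ a = W i := by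
  cases d with
  | zero => simp [window] at h
  | succ d =>
    simp [window, List.ofFn_succ] at h
    exact ⟨by omega, h.symm⟩

theorem getLast?_window {i : ZMod N} {d : ℕ} {a : Letter n} (h : a ∈ (window W i d).getLast?) :
    0 < d ∧ a = W (i + d - 1) := by
  cases d with
  | zero => simp [window] at h
  | succ d =>
    simp only [window, List.ofFn_succ_last, List.getLast?_append, List.getLast?_singleton] at h
    simp at h
    refine ⟨by omega, ?_⟩
    rw [← h]
    congr 1
    push_cast
    ring

end Window

variable {w z : List (Letter n)} [NeZero w.length] [NeZero z.length] {u : List (Letter n)}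

theorem rotate_eq_window (k : ℕ) : w.rotate k = window (closedWord w) k w.length :=
  rotate_eq_ofFn w k

theorem isCyclicallyReduced_append {L L' : List (Letter n)} (h0 : L ≠ []) (h0' : L' ≠ [])
    (h : FreeGroup.IsReduced L) (h' : FreeGroup.IsReduced L')
    (hj : ∀ a ∈ L.getLast?, ∀ b ∈ L'.head?, a ≠ bar b)
    (hj' : ∀ a ∈ L'.getLast?, ∀ b ∈ L.head?, a ≠ bar b) :
    FreeGroup.IsCyclicallyReduced (L ++ L') := by
  rw [isCyclicallyReduced_iff']
  refine ⟨isReduced_append h h' hj, ?_⟩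
  rw [List.getLast?_append_of_ne_nil _ h0', List.head?_append_of_ne_nil _ h0]
  exact hj'

theorem window_ne_nil {N : ℕ} {W : ZMod N → Letter n} {i : ZMod N} {d : ℕ} (hd : 0 < d) :
    window W i d ≠ [] := by
  rw [← List.length_pos_iff, length_window]
  exact hd

/-- In type 3 only the triviality of the product has to be excluded. -/
theorem isReducedCyclic_gamma_of_linked3 (hW : IsReducedClosed (closedWord w))
    (hZ : IsReducedClosed (closedWord z)) {O : Cycle (Letter n)}
    (x : Fin w.length × Fin z.length × ℕ)
    (h3 : Linked3 O (subword w x.1 x.2.2) (subword z x.2.1 x.2.2)) :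
    IsReducedCyclic (gamma O w z x) := by
  obtain ⟨i, j, m⟩ := x
  have hw0 := Nat.pos_of_ne_zero (NeZero.ne w.length)
  have hg := cycleCls_gamma_of_linked3 _ h3
  rw [gamma, if_pos h3] at hg ⊢
  refine isReducedCyclic_coe (fun h0 => ?_)
    (FreeGroup.reduceCyclically.isCyclicallyReduced (isReduced_reduce _))
  -- In the other order, the product of the two representatives is freely reduced, since the letters
  -- `q₁` and `p₂` that meet do not cancel; hence it is not trivial.
  rw [h0, joined, cls_mul_comm, cycleCls_coe, ← FreeGroup.one_eq_mk] at hg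
  have h1 := cls_injective_one hg.symm
  rw [full, full, ← mk_window, ← mk_window, FreeGroup.mul_mk] at h1
  refine mk_ne_one ?_ (isReduced_append (isReduced_window hZ _ _) (isReduced_window hW _ _) ?_) h1
  · simp [window_ne_nil hw0]
  · intro a ha b hb
    rw [(getLast?_window ha).2, (head?_window hb).2, ZMod.natCast_self]
    have := h3.2.2.2.1
    rw [subword_last, subword_zero, ← bar_injective.ne_iff, bar_bar] at this
    simpa using this.symm

theorem isReducedCyclic_gamma (hn : u.Nodup) (hu : ∀ x, x ∈ u)
    (hW : IsReducedClosed (closedWord w)) (hZ : IsReducedClosed (closedWord z))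
    (x : Fin w.length × Fin z.length × ℕ) (hx : x ∈ LP (u : Cycle (Letter n)) w z) :
    IsReducedCyclic (gamma (u : Cycle (Letter n)) w z x) := by
  by_cases h3 : Linked3 (u : Cycle (Letter n)) (subword w x.1 x.2.2) (subword z x.2.1 x.2.2)
  · exact isReducedCyclic_gamma_of_linked3 hW hZ x h3
  obtain ⟨i, j, m⟩ := x
  have hw0 := Nat.pos_of_ne_zero (NeZero.ne w.length)
  have hz0 := Nat.pos_of_ne_zero (NeZero.ne z.length)
  have hj : closedWord w ((i : ℕ) + 1 + m - 1) ≠ bar (closedWord z ((j : ℕ) + 1 + m)) ∧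
      closedWord z ((j : ℕ) + 1 + m - 1) ≠ bar (closedWord w ((i : ℕ) + 1 + m)) := by
    rw [LP_eq_union hW hZ] at hx
    rcases hx with hx | hx | hx
    · have h1 := (linked1_iff i j m).1 hx
      obtain rfl : m = 0 := h1.1
      constructor
      · intro h
        refine h1.2 (orient_four_eq_zero hn hu (.inr (.inr (.inr (.inr (.inl ?_))))))
        simp only [Nat.cast_zero, add_zero] at h
        simp only
        rw [h, bar_bar]
      · intro h
        refine h1.2 (orient_four_eq_zero hn hu (.inr (.inr (.inr (.inr (.inr ?_))))))
        simp only [Nat.cast_zero, add_zero] at h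
        simp only
        rw [h, bar_bar]
    · have h2 := ((linked2_iff hn hu i j m).1 hx).1
      have hm : 1 ≤ m := h2.1
      have he : closedWord w ((i : ℕ) + 1 + m - 1) = closedWord z ((j : ℕ) + 1 + m - 1) := by
        have := h2.2.2.1 (m - 1) (show m - 1 < m by omega)
        simp only [SameExit, parallel_pow] at this
        rw [Nat.cast_sub hm, Nat.cast_sub hm] at this
        convert this using 2 <;> push_cast <;> ring
      have h3 := hW ((i : ℕ) + 1 + m - 1)
      have h4 := hZ ((j : ℕ) + 1 + m - 1)
      rw [sub_add_cancel] at h3 h4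
      exact ⟨he ▸ h4, he ▸ h3⟩
    · exact (h3 hx).elim
  rw [gamma, if_neg h3]
  refine isReducedCyclic_coe ?_ ?_
  · simp [rotate_eq_window, window_ne_nil hw0]
  rw [rotate_eq_window, rotate_eq_window]
  refine isCyclicallyReduced_append (window_ne_nil hw0) (window_ne_nil hz0)
    (isReduced_window hW _ _) (isReduced_window hZ _ _) ?_ ?_
  · intro a ha b hb
    rw [(getLast?_window ha).2, (head?_window hb).2, ZMod.natCast_self]
    convert hj.1 using 2
    · push_cast; ring_nf
    · push_cast; ring_nf
  · intro a ha b hb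
    rw [(getLast?_window ha).2, (head?_window hb).2, ZMod.natCast_self]
    convert hj.2 using 2
    · push_cast; ring_nf
    · push_cast; ring_nf

/-- Reading a word and then its inverse gives the trivial element of the free group. -/
theorem seg_mul_seg_eq_one {N M : ℕ} {W : ZMod N → Letter n} {Z : ZMod M → Letter n} {i : ZMod N}
    {j : ZMod M} {m : ℕ} (h : ∀ t < m, W (i + t) = bar (Z (j + m - t - 1))) :
    seg W i m * seg Z j m = 1 := by
  have key : ∀ t ≤ m, seg W i t * seg Z (j + m - t) t = 1 := by
    intro t
    induction t with
    | zero => simp [seg]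
    | succ t ih =>
      intro ht
      have h1 := seg_add Z (j + m - (t + 1 : ℕ)) 1 t
      rw [seg_one, Nat.cast_one, show j + (m : ZMod M) - ((t + 1 : ℕ) : ZMod M) + 1 = j + m - t by
        push_cast; ring, add_comm 1 t] at h1
      have h2 := h t (by omega)
      rw [show j + (m : ZMod M) - t - 1 = j + m - (t + 1 : ℕ) by push_cast; ring] at h2
      rw [h1, seg, h2, letterElt_bar, mul_assoc, inv_mul_cancel_left]
      exact ih (by omega)
  simpa using key m le_rfl

/-- If `Y` is not longer than the two words, then only `Y` and `Ȳ` cancel in the product. -/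
theorem gamma_of_linked3_of_le (hn : u.Nodup) (hu : ∀ x, x ∈ u)
    (hW : IsReducedClosed (closedWord w)) (hZ : IsReducedClosed (closedWord z))
    (x : Fin w.length × Fin z.length × ℕ)
    (h3 : Linked3 (u : Cycle (Letter n)) (subword w x.1 x.2.2) (subword z x.2.1 x.2.2))
    (hmw : x.2.2 ≤ w.length) (hmz : x.2.2 ≤ z.length) :
    gamma (u : Cycle (Letter n)) w z x =
      (((w.rotate (x.1 + x.2.2 + 1)).take (w.length - x.2.2) ++
        (z.rotate (x.2.1 + x.2.2 + 1)).take (z.length - x.2.2) : List (Letter n)) :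
          Cycle (Letter n)) := by
  obtain ⟨i, j, m⟩ := x
  simp only at hmw hmz h3 ⊢
  have hr := ((linked3_iff hn hu i j m).1 h3).1
  have ho := h3.2.2.2.2
  have hm := h3.1
  rw [subword_zero, subword_zero, subword_last, subword_last, subword_one,
    subword_rev_one _ _ hm] at ho
  rw [gamma, if_pos h3]
  simp only
  set I : ZMod w.length := (i : ℕ) + 1 with hI
  set J : ZMod z.length := (j : ℕ) + 1 with hJ
  have hrun : ∀ t < m, closedWord w (I + t) = bar (closedWord z (J + m - t - 1)) := by
    intro t ht
    have := hr.2.2.1 t ht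
    simpa only [antiparallel_pow, OppositeExit] using this
  have hfirst : closedWord w (I - 1) ≠ bar (closedWord z (J + m)) := by
    have := hr.2.1
    simpa only [antiparallel_inv, OppositeExit, add_sub_cancel_right] using this
  have hlast : closedWord w (I + m) ≠ bar (closedWord z (J - 1)) := by
    have := hr.2.2.2
    simpa only [antiparallel_pow, OppositeExit, add_sub_cancel_right] using this
  have cw : ((w.length - m : ℕ) : ZMod w.length) = -m := by
    rw [Nat.cast_sub hmw, ZMod.natCast_self, zero_sub]
  have cz : ((z.length - m : ℕ) : ZMod z.length) = -m := by
    rw [Nat.cast_sub hmz, ZMod.natCast_self, zero_sub]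
  have rw1 : w.rotate (i + m + 1) =
      window (closedWord w) (I + m) (w.length - m) ++ window (closedWord w) I m := by
    have := window_add (W := closedWord w) (I + m) (w.length - m) m
    rw [cw, add_neg_cancel_right, Nat.sub_add_cancel hmw] at this
    rw [← this, rotate_eq_window]
    congr 1
    rw [hI]
    push_cast
    ring
  have rz1 : z.rotate (j + 1) =
      window (closedWord z) J m ++ window (closedWord z) (J + m) (z.length - m) := by
    rw [← window_add, Nat.add_sub_cancel' hmz, rotate_eq_window]
    congr 1
    rw [hJ]
    push_cast
    ring
  have rz2 : z.rotate (j + m + 1) =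
      window (closedWord z) (J + m) (z.length - m) ++ window (closedWord z) J m := by
    have := window_add (W := closedWord z) (J + m) (z.length - m) m
    rw [cz, add_neg_cancel_right, Nat.sub_add_cancel hmz] at this
    rw [← this, rotate_eq_window]
    congr 1
    rw [hJ]
    push_cast
    ring
  have hV : FreeGroup.IsCyclicallyReduced (window (closedWord w) (I + m) (w.length - m) ++
      window (closedWord z) (J + m) (z.length - m)) := by
    have hWW := isReduced_window hW (I + m) (w.length - m)
    have hZZ := isReduced_window hZ (J + m) (z.length - m)
    have lastW : ∀ {a}, a ∈ (window (closedWord w) (I + m) (w.length - m)).getLast? →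
        a = closedWord w (I - 1) := fun h => by
      rw [(getLast?_window h).2, cw, add_neg_cancel_right]
    have lastZ : ∀ {a}, a ∈ (window (closedWord z) (J + m) (z.length - m)).getLast? →
        a = closedWord z (J - 1) := fun h => by
      rw [(getLast?_window h).2, cz, add_neg_cancel_right]
    -- If one of the words is used up by `Y`, the two signs of the linked pair compare the same
    -- letters, and they are opposite unless the remaining word is cyclically reduced.
    have horient : ∀ {a b c : Letter n}, a ≠ b → b ≠ c → c ≠ a →
        orient (u : Cycle (Letter n)) ([a, b, c] : List (Letter n)) ≠
          orient (u : Cycle (Letter n)) ([a, c, b] : List (Letter n)) := by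
      intro a b c hab hbc hca h
      have h0 := orient_three_ne_zero hn hu hab hbc hca
      rw [orient_three_swap hn hu a b c] at h
      omega
    rcases hmw.eq_or_lt with hmw' | hmw' <;> rcases hmz.eq_or_lt with hmz' | hmz'
    · exfalso
      have cw' : (m : ZMod w.length) = 0 := by rw [hmw', ZMod.natCast_self]
      have cz' : (m : ZMod z.length) = 0 := by rw [hmz', ZMod.natCast_self]
      have := hrun (m - 1) (by omega)
      rw [Nat.cast_sub hm, Nat.cast_sub hm, Nat.cast_one, Nat.cast_one, cw', cz', add_zero,
        zero_sub, zero_sub, sub_neg_eq_add, add_sub_cancel_right, ← sub_eq_add_neg] at this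
      rw [cz', add_zero] at hfirst
      exact hfirst this
    · have cw' : (m : ZMod w.length) = 0 := by rw [hmw', ZMod.natCast_self]
      rw [show w.length - m = 0 by omega, show window (closedWord w) (I + m) 0 = [] from rfl,
        List.nil_append, isCyclicallyReduced_iff']
      refine ⟨hZZ, fun a ha b hb hab => ?_⟩
      rw [lastZ ha, (head?_window hb).2] at hab
      rw [cw', add_zero, hab, bar_bar] at ho
      rw [cw', add_zero, hab, bar_bar] at hlast
      refine horient (fun h => ?_) (hW.ne_pred I) hlast ho
      rw [← bar_injective.eq_iff, bar_bar] at h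
      exact hfirst h.symm
    · have cz' : (m : ZMod z.length) = 0 := by rw [hmz', ZMod.natCast_self]
      rw [show z.length - m = 0 by omega, show window (closedWord z) (J + m) 0 = [] from rfl,
        List.append_nil, isCyclicallyReduced_iff']
      refine ⟨hWW, fun a ha b hb hab => ?_⟩
      rw [lastW ha, (head?_window hb).2] at hab
      have h0 := hrun 0 hm
      have h1 := hrun (m - 1) (by omega)
      rw [Nat.cast_sub hm, Nat.cast_sub hm, Nat.cast_one, Nat.cast_one, cz', add_zero,
        zero_sub, sub_neg_eq_add, add_sub_cancel_right, ← add_sub_assoc] at h1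
      rw [cz', Nat.cast_zero, Nat.cast_zero, add_zero, add_zero, sub_zero] at h0
      rw [cz', add_zero, h1, hab, bar_bar, bar_bar, ← h0] at ho
      rw [cz', add_zero, hab, bar_injective.ne_iff] at hfirst
      rw [← h0] at hlast
      have h5 : closedWord z J ≠ closedWord w I := by
        rw [h0]
        exact (hZ.ne_pred J).symm
      refine horient hfirst.symm hlast h5.symm (ho.trans ?_)
      rw [orient_three hn hu, orient_three hn hu]
      ring
    · refine isCyclicallyReduced_append (window_ne_nil (by omega)) (window_ne_nil (by omega))
        hWW hZZ (fun a ha b hb => ?_) fun a ha b hb => ?_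
      · rw [lastW ha, (head?_window hb).2]
        exact hfirst
      · rw [lastZ ha, (head?_window hb).2, ← bar_injective.ne_iff, bar_bar]
        exact hlast.symm
  have hmk : FreeGroup.mk (w.rotate (i + m + 1) ++ z.rotate (j + 1)) =
      FreeGroup.mk (window (closedWord w) (I + m) (w.length - m) ++
        window (closedWord z) (J + m) (z.length - m)) := by
    rw [rw1, rz1]
    simp only [← FreeGroup.mul_mk, mk_window]
    rw [mul_assoc, ← mul_assoc (seg (closedWord w) I m), seg_mul_seg_eq_one hrun, one_mul]
  rw [FreeGroup.reduce.sound hmk, hV.isReduced.reduce_eq, reduceCyclically_eq_self hV, rw1, rz2,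
    List.take_left' (length_window _ _), List.take_left' (length_window _ _)]

end Gamma

/-! ### Conjugacy classes and reduced cyclic words -/

section Conjugacy

variable {n : ℕ}

theorem IsReducedCyclic.isCyclicallyReduced {w : List (Letter n)}
    (hw : IsReducedCyclic (w : Cycle (Letter n))) : FreeGroup.IsCyclicallyReduced w := by
  have := neZero_length hw
  have hW := isReducedClosed hw
  have h : w = window (closedWord w) 0 w.length := by
    have h0 := rotate_eq_window (w := w) 0
    rwa [List.rotate_zero, Nat.cast_zero] at h0
  rw [isCyclicallyReduced_iff', h]
  refine ⟨isReduced_window hW _ _, fun a ha b hb => ?_⟩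
  rw [(getLast?_window ha).2, (head?_window hb).2, ZMod.natCast_self]
  have := hW (0 - 1)
  rw [sub_add_cancel] at this
  rwa [add_zero]

/-- The cyclic word obtained by cyclically reducing an element of the free group. -/
def cyclicReduction (g : FreeGroup (Fin n)) : Cycle (Letter n) :=
  (FreeGroup.reduceCyclically g.toWord : List (Letter n))

theorem cyclicReduction_mk {w : List (Letter n)} (hw : FreeGroup.IsCyclicallyReduced w) :
    cyclicReduction (FreeGroup.mk w) = (w : Cycle (Letter n)) := by
  rw [cyclicReduction, FreeGroup.toWord_mk, hw.isReduced.reduce_eq, reduceCyclically_eq_self hw]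

theorem cyclicReduction_cons_append {a : Letter n} (L : List (Letter n)) :
    FreeGroup.reduceCyclically (a :: (L ++ [bar a])) = FreeGroup.reduceCyclically L := by
  rw [FreeGroup.reduceCyclically.cons_append, if_pos]
  simp [bar]

/-- A cyclically reduced word stays so after moving its first letter to the end. -/
theorem cyclicReduction_rotate {a : Letter n} {L : List (Letter n)}
    (h : FreeGroup.IsCyclicallyReduced (a :: L)) :
    cyclicReduction (FreeGroup.mk (L ++ [a])) = cyclicReduction (FreeGroup.mk (a :: L)) := by
  have hc : ((L ++ [a] : List (Letter n)) : Cycle (Letter n)) = (a :: L : List (Letter n)) :=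
    (Cycle.coe_cons_eq_coe_append L a).symm
  have h' : IsReducedCyclic ((L ++ [a] : List (Letter n)) : Cycle (Letter n)) := by
    rw [hc]
    exact isReducedCyclic_coe (by simp) h
  rw [cyclicReduction_mk h, cyclicReduction_mk h'.isCyclicallyReduced, hc]

theorem mk_cons_bar_cons (a : Letter n) (L : List (Letter n)) :
    FreeGroup.mk (a :: bar a :: L) = FreeGroup.mk L := by
  have h : FreeGroup.mk (a :: bar a :: L) = letterElt a * letterElt (bar a) * FreeGroup.mk L := by
    simp [letterElt, FreeGroup.mul_mk]
  rw [h, letterElt_bar, mul_inv_cancel, one_mul]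

/-- Conjugation by a letter does not change the cyclic reduction. If only one of the two new letters
cancels against an end of the reduced word, then the word is cyclically reduced and gets rotated. -/
theorem cyclicReduction_letterElt_conj (a : Letter n) (g : FreeGroup (Fin n)) :
    cyclicReduction (letterElt a * g * (letterElt a)⁻¹) = cyclicReduction g := by
  have hL : FreeGroup.IsReduced g.toWord := FreeGroup.isReduced_toWord
  have hg : g = FreeGroup.mk g.toWord := FreeGroup.mk_toWord.symm
  generalize g.toWord = L at hL hg
  subst hg
  have hconj : letterElt a * FreeGroup.mk L * (letterElt a)⁻¹ =
      FreeGroup.mk (a :: (L ++ [bar a])) := by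
    rw [← letterElt_bar, letterElt, letterElt, FreeGroup.mul_mk, FreeGroup.mul_mk]
    rfl
  have hcancel : ∀ M : List (Letter n), FreeGroup.mk (M ++ [a, bar a]) = FreeGroup.mk M := by
    intro M
    rw [← FreeGroup.mul_mk, mk_cons_bar_cons, FreeGroup.mul_mk, List.append_nil]
  by_cases h1 : L.head? = some (bar a)
  · obtain ⟨M, rfl⟩ := List.head?_eq_some_iff.1 h1
    rw [hconj, List.cons_append, mk_cons_bar_cons]
    by_cases h2 : M.getLast? = some a
    · -- Both ends of `L` cancel.
      obtain ⟨M', rfl⟩ := List.getLast?_eq_some_iff.1 h2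
      have hM' : FreeGroup.IsReduced M' := hL.infix ⟨[bar a], [a], by simp⟩
      rw [List.append_assoc, List.singleton_append, hcancel]
      have := cyclicReduction_cons_append (a := bar a) M'
      rw [bar_bar] at this
      rw [cyclicReduction, cyclicReduction, FreeGroup.toWord_mk, FreeGroup.toWord_mk,
        hL.reduce_eq, hM'.reduce_eq, this]
    · refine cyclicReduction_rotate ((isCyclicallyReduced_iff' _).2 ⟨hL, ?_⟩)
      intro b hb c hc hbc
      simp only [List.head?_cons, Option.mem_def, Option.some.injEq] at hc
      rw [← hc, bar_bar] at hbc
      rw [hbc, Option.mem_def, List.getLast?_cons] at hb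
      cases hM : M.getLast? with
      | none =>
        rw [hM] at hb
        exact bar_ne a (by simpa using hb)
      | some d =>
        rw [hM] at hb h2
        exact h2 (by simpa using hb)
  · by_cases h2 : L.getLast? = some a
    · obtain ⟨M, rfl⟩ := List.getLast?_eq_some_iff.1 h2
      rw [hconj, List.append_assoc, List.singleton_append, ← List.cons_append, hcancel]
      symm
      refine cyclicReduction_rotate ((isCyclicallyReduced_iff' _).2 ⟨?_, ?_⟩)
      · have hM : FreeGroup.IsReduced M := hL.infix ⟨[], [a], by simp⟩
        refine isReduced_append (L := [a]) FreeGroup.IsReduced.singleton hM ?_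
        intro b hb c hc hbc
        simp only [List.getLast?_singleton, Option.mem_def, Option.some.injEq] at hb
        rw [Option.mem_def] at hc
        refine h1 ?_
        rw [List.head?_append, hc, hb, hbc, bar_bar]
        rfl
      · intro b hb c hc hbc
        simp only [List.head?_cons, Option.mem_def, Option.some.injEq] at hc
        subst hc
        rw [isReduced_iff] at hL
        have h3 := (List.isChain_append.1 hL).2.2
        rw [Option.mem_def, List.getLast?_cons] at hb
        cases hM : M.getLast? with
        | none =>
          rw [hM] at hb
          exact bar_ne a (hbc ▸ (by simpa using hb.symm))
        | some d =>
          rw [hM] at hb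
          have hdb : d = b := by simpa using hb
          exact h3 d hM a (by simp) (hdb.trans hbc)
    · rw [hconj]
      by_cases h0 : L = []
      · subst h0
        rw [List.nil_append, mk_cons_bar_cons]
      have hr : FreeGroup.IsReduced (a :: (L ++ [bar a])) := by
        refine isReduced_append (L := [a]) FreeGroup.IsReduced.singleton
          (isReduced_append hL FreeGroup.IsReduced.singleton ?_) ?_
        · intro b hb c hc hbc
          simp only [List.head?_cons, Option.mem_def, Option.some.injEq] at hc
          rw [← hc, bar_bar] at hbc
          rw [hbc] at hb
          exact h2 hb
        · intro b hb c hc hbc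
          simp only [List.getLast?_singleton, Option.mem_def, Option.some.injEq] at hb
          have hc' : c ∈ (L ++ [bar a]).head? := hc
          rw [List.head?_append_of_ne_nil _ h0] at hc'
          refine h1 ?_
          rw [hb, hbc, bar_bar]
          exact hc'
      rw [cyclicReduction, cyclicReduction, FreeGroup.toWord_mk, FreeGroup.toWord_mk,
        hL.reduce_eq, hr.reduce_eq, cyclicReduction_cons_append]

theorem cyclicReduction_eq_of_isConj {g h : FreeGroup (Fin n)} (hgh : IsConj g h) :
    cyclicReduction g = cyclicReduction h := by
  obtain ⟨c, rfl⟩ := isConj_iff.1 hgh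
  clear hgh
  rw [← FreeGroup.mk_toWord (x := c)]
  induction c.toWord with
  | nil => simp [← FreeGroup.one_eq_mk]
  | cons a l ih =>
    have : FreeGroup.mk (a :: l) = letterElt a * FreeGroup.mk l := by
      simp [letterElt, FreeGroup.mul_mk]
    rw [this, ih, mul_inv_rev, ← cyclicReduction_letterElt_conj a]
    simp only [mul_assoc]

theorem isConj_of_cls_eq {g h : FreeGroup (Fin n)} (hgh : cls g = cls h) : IsConj g h :=
  ConjClasses.mk_eq_mk_iff_isConj.1 (Finsupp.single_left_injective one_ne_zero hgh)

/-- Reduced cyclic words that represent the same conjugacy class are equal. -/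
theorem cycleCls_injOn : Set.InjOn cycleCls {C : Cycle (Letter n) | IsReducedCyclic C} := by
  intro C hC C' hC' h
  induction C using Quotient.inductionOn with
  | h w =>
    induction C' using Quotient.inductionOn with
    | h w' =>
      have := cyclicReduction_eq_of_isConj (isConj_of_cls_eq h)
      rwa [cyclicReduction_mk (IsReducedCyclic.isCyclicallyReduced hC),
        cyclicReduction_mk (IsReducedCyclic.isCyclicallyReduced hC')] at this

end Conjugacy

/-! ### The bracket over the integers -/

section IntegralBracket

variable {n : ℕ}

theorem bracket_single_single (k : Type*) [CommRing k] (O : Cycle (Letter n))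
    (W Z : ReducedCyclicWord n) :
    bracket k O (Finsupp.single W 1) (Finsupp.single Z 1) =
      bracketSum k O (Quotient.out W.1) (Quotient.out Z.1) := by
  rw [bracket, Finsupp.lift_apply, Finsupp.sum_single_index (by rw [zero_smul]), one_smul,
    Finsupp.lift_apply, Finsupp.sum_single_index (by rw [zero_smul]), one_smul]

theorem ofCycle_of_isReducedCyclic (k : Type*) [CommRing k] {C : Cycle (Letter n)}
    (hC : IsReducedCyclic C) : ofCycle k C = Finsupp.single ⟨C, hC⟩ 1 := by
  rw [ofCycle, dif_pos hC]

theorem coe_out (C : Cycle (Letter n)) :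
    ((Quotient.out C : List (Letter n)) : Cycle (Letter n)) = C :=
  Quotient.out_eq C

/-- The conjugacy class represented by a reduced cyclic word. -/
noncomputable def wordClass (W : ReducedCyclicWord n) : ConjClasses (FreeGroup (Fin n)) :=
  ConjClasses.mk (FreeGroup.mk (Quotient.out W.1))

theorem single_wordClass (W : ReducedCyclicWord n) :
    Finsupp.single (wordClass W) 1 = cycleCls W.1 := by
  conv_rhs => rw [← coe_out W.1]
  rw [cycleCls_coe]
  rfl

theorem wordClass_injective : Function.Injective (wordClass (n := n)) := by
  intro W W' h
  refine Subtype.ext (cycleCls_injOn W.2 W'.2 ?_)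
  rw [← single_wordClass, ← single_wordClass, h]

/-- The embedding of the free module on the reduced cyclic words into the free module on the
conjugacy classes. -/
noncomputable def toClasses : V ℤ n →ₗ[ℤ] (ConjClasses (FreeGroup (Fin n)) →₀ ℤ) :=
  Finsupp.lmapDomain ℤ ℤ wordClass

theorem toClasses_injective : Function.Injective (toClasses (n := n)) :=
  Finsupp.mapDomain_injective wordClass_injective

theorem toClasses_single (W : ReducedCyclicWord n) :
    toClasses (Finsupp.single W 1) = cycleCls W.1 := by
  rw [toClasses, Finsupp.lmapDomain_apply, Finsupp.mapDomain_single, single_wordClass]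

theorem toClasses_ofCycle {C : Cycle (Letter n)} (hC : IsReducedCyclic C) :
    toClasses (ofCycle ℤ C) = cycleCls C := by
  exact (congrArg _ (ofCycle_of_isReducedCyclic ℤ hC)).trans (toClasses_single ⟨C, hC⟩)

/-- Since the free modules over `ℤ` have no torsion, elements of `V ℤ n` can be compared up to a
factor in the free module on the conjugacy classes. -/
theorem eq_of_smul_toClasses_eq {c : ℤ} (hc : c ≠ 0) {x y : V ℤ n}
    (h : c • toClasses x = c • toClasses y) : x = y :=
  toClasses_injective (smul_right_injective _ hc h)

variable {u : List (Letter n)}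

theorem two_smul_toClasses_bracketSum (hn : u.Nodup) (hu : ∀ x, x ∈ u) {w z : List (Letter n)}
    (hw : IsReducedCyclic (w : Cycle (Letter n))) (hz : IsReducedCyclic (z : Cycle (Letter n))) :
    (2 : ℤ) • toClasses (bracketSum ℤ (u : Cycle (Letter n)) w z) =
      loopBr (pos u) (FreeGroup.mk w) (FreeGroup.mk z) := by
  have := neZero_length hw
  have := neZero_length hz
  have hW := isReducedClosed hw
  have hZ := isReducedClosed hz
  rw [← two_smul_sum_LP hn hu hW hZ, bracketSum, ← LinearMap.toAddMonoidHom_coe,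
    AddMonoidHom.map_finsum_mem _ _ (LP_finite hn hu hW hZ)]
  congr 1
  refine finsum_mem_congr rfl fun x hx => ?_
  rw [LinearMap.toAddMonoidHom_coe, map_smul,
    toClasses_ofCycle (isReducedCyclic_gamma hn hu hW hZ x hx)]

theorem two_smul_toClasses_bracket (hn : u.Nodup) (hu : ∀ x, x ∈ u) (x y : V ℤ n) :
    (2 : ℤ) • toClasses (bracket ℤ (u : Cycle (Letter n)) x y) =
      loopBracket (pos u) (toClasses x) (toClasses y) := by
  induction x using Finsupp.induction_linear with
  | zero => simp
  | add x x' hx hx' => simp only [map_add, LinearMap.add_apply, smul_add, hx, hx']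
  | single W a =>
    induction y using Finsupp.induction_linear with
    | zero => simp
    | add y y' hy hy' => simp only [map_add, smul_add, hy, hy']
    | single Z b =>
      rw [← mul_one a, ← mul_one b, ← smul_eq_mul, ← smul_eq_mul, ← Finsupp.smul_single,
        ← Finsupp.smul_single]
      simp only [map_smul, LinearMap.smul_apply]
      rw [smul_comm (2 : ℤ), smul_comm (2 : ℤ), bracket_single_single,
        two_smul_toClasses_bracketSum hn hu, toClasses_single, toClasses_single]
      · conv_rhs => rw [← coe_out W.1, ← coe_out Z.1]
        rw [cycleCls_coe, cycleCls_coe, loopBracket_cls]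
      · rw [coe_out]; exact W.2
      · rw [coe_out]; exact Z.2

theorem exists_toClasses_single_eq (W : ReducedCyclicWord n) :
    ∃ (N : ℕ) (_ : NeZero N) (U : ZMod N → Letter n),
      toClasses (Finsupp.single W 1) = cls (full U 0) := by
  have hW : IsReducedCyclic ((Quotient.out W.1 : List (Letter n)) : Cycle (Letter n)) := by
    rw [coe_out]
    exact W.2
  have := neZero_length hW
  refine ⟨_, this, closedWord (Quotient.out W.1), ?_⟩
  have h := mk_rotate (Quotient.out W.1) 0
  rw [List.rotate_zero, Nat.cast_zero] at h
  rw [toClasses_single, ← h, ← cycleCls_coe, coe_out]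

theorem bracket_int_single_swap (hn : u.Nodup) (hu : ∀ x, x ∈ u) (W Z : ReducedCyclicWord n) :
    bracket ℤ (u : Cycle (Letter n)) (Finsupp.single W 1) (Finsupp.single Z 1) =
      -bracket ℤ (u : Cycle (Letter n)) (Finsupp.single Z 1) (Finsupp.single W 1) := by
  refine eq_of_smul_toClasses_eq (two_ne_zero) ?_
  obtain ⟨N, _, U, hU⟩ := exists_toClasses_single_eq W
  obtain ⟨M, _, U', hU'⟩ := exists_toClasses_single_eq Z
  rw [map_neg, smul_neg, two_smul_toClasses_bracket hn hu, two_smul_toClasses_bracket hn hu, hU,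
    hU', loopBracket_cls, loopBracket_cls, loopBr_full_swap]

theorem bracket_int_single_self (hn : u.Nodup) (hu : ∀ x, x ∈ u) (W : ReducedCyclicWord n) :
    bracket ℤ (u : Cycle (Letter n)) (Finsupp.single W 1) (Finsupp.single W 1) = 0 :=
  self_eq_neg.1 (bracket_int_single_swap hn hu W W)

theorem bracket_int_single_jacobi (hn : u.Nodup) (hu : ∀ x, x ∈ u) (X Y Z : ReducedCyclicWord n) :
    bracket ℤ (u : Cycle (Letter n)) (Finsupp.single X 1)
        (bracket ℤ (u : Cycle (Letter n)) (Finsupp.single Y 1) (Finsupp.single Z 1)) +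
      bracket ℤ (u : Cycle (Letter n)) (Finsupp.single Y 1)
        (bracket ℤ (u : Cycle (Letter n)) (Finsupp.single Z 1) (Finsupp.single X 1)) +
      bracket ℤ (u : Cycle (Letter n)) (Finsupp.single Z 1)
        (bracket ℤ (u : Cycle (Letter n)) (Finsupp.single X 1) (Finsupp.single Y 1)) = 0 := by
  refine eq_of_smul_toClasses_eq (c := 2 * 2) (by norm_num) ?_
  obtain ⟨A, _, U, hU⟩ := exists_toClasses_single_eq X
  obtain ⟨B, _, U', hU'⟩ := exists_toClasses_single_eq Y
  obtain ⟨C, _, U'', hU''⟩ := exists_toClasses_single_eq Z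
  have h : ∀ x y z : V ℤ n,
      (2 * 2 : ℤ) • toClasses (bracket ℤ (u : Cycle (Letter n)) x
        (bracket ℤ (u : Cycle (Letter n)) y z)) =
      loopBracket (pos u) (toClasses x) (loopBracket (pos u) (toClasses y) (toClasses z)) := by
    intro x y z
    rw [mul_smul, two_smul_toClasses_bracket hn hu, ← map_smul, two_smul_toClasses_bracket hn hu]
  rw [map_add, map_add, smul_add, smul_add, h, h, h, hU, hU', hU'', map_zero, smul_zero]
  exact loopBracket_jacobi (pos u) (pos_injective hu) U U' U''

end IntegralBracket

/-! ### Extension of scalars -/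

section ExtensionOfScalars

variable {n : ℕ} (k : Type*) [CommRing k]

/-- Extension of scalars from `ℤ` to `k`. -/
noncomputable def extendScalars : V ℤ n →+ V k n :=
  Finsupp.mapRange.addMonoidHom (Int.castAddHom k)

theorem extendScalars_single (W : ReducedCyclicWord n) :
    extendScalars k (Finsupp.single W 1) = Finsupp.single W 1 := by
  simp [extendScalars]

theorem extendScalars_ofCycle (C : Cycle (Letter n)) :
    extendScalars k (ofCycle ℤ C) = ofCycle k C := by
  rw [ofCycle, ofCycle]
  split_ifs
  · exact extendScalars_single k _
  · exact map_zero _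

theorem extendScalars_bracketSum (O : Cycle (Letter n)) {w z : List (Letter n)}
    (h : (LP O w z).Finite) :
    extendScalars k (bracketSum ℤ O w z) = bracketSum k O w z := by
  rw [bracketSum, AddMonoidHom.map_finsum_mem _ _ h, bracketSum]
  refine finsum_mem_congr rfl fun x _ => ?_
  rw [map_zsmul, extendScalars_ofCycle]

variable {u : List (Letter n)}

theorem LP_out_finite (hn : u.Nodup) (hu : ∀ x, x ∈ u) (W Z : ReducedCyclicWord n) :
    (LP (u : Cycle (Letter n)) (Quotient.out W.1) (Quotient.out Z.1)).Finite := by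
  have hW : IsReducedCyclic ((Quotient.out W.1 : List (Letter n)) : Cycle (Letter n)) := by
    rw [coe_out]
    exact W.2
  have hZ : IsReducedCyclic ((Quotient.out Z.1 : List (Letter n)) : Cycle (Letter n)) := by
    rw [coe_out]
    exact Z.2
  have := neZero_length hW
  have := neZero_length hZ
  exact LP_finite hn hu (isReducedClosed hW) (isReducedClosed hZ)

theorem extendScalars_bracket (hn : u.Nodup) (hu : ∀ x, x ∈ u) (x y : V ℤ n) :
    extendScalars k (bracket ℤ (u : Cycle (Letter n)) x y) =
      bracket k (u : Cycle (Letter n)) (extendScalars k x) (extendScalars k y) := by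
  induction x using Finsupp.induction_linear with
  | zero => simp
  | add x x' hx hx' => simp only [map_add, LinearMap.add_apply, hx, hx']
  | single W a =>
    induction y using Finsupp.induction_linear with
    | zero => simp
    | add y y' hy hy' => simp only [map_add, hy, hy']
    | single Z b =>
      rw [← mul_one a, ← mul_one b, ← smul_eq_mul, ← smul_eq_mul, ← Finsupp.smul_single,
        ← Finsupp.smul_single]
      simp only [map_zsmul, LinearMap.smul_apply, extendScalars_single]
      rw [bracket_single_single, bracket_single_single, extendScalars_bracketSum k _
        (LP_out_finite hn hu W Z)]

/-- The bracket does not depend on the choice of linear representatives. -/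
theorem bracket_ofCycle (hn : u.Nodup) (hu : ∀ x, x ∈ u) {w z : List (Letter n)}
    (hw : IsReducedCyclic (w : Cycle (Letter n))) (hz : IsReducedCyclic (z : Cycle (Letter n))) :
    bracket k (u : Cycle (Letter n)) (ofCycle k (w : Cycle (Letter n)))
      (ofCycle k (z : Cycle (Letter n))) = bracketSum k (u : Cycle (Letter n)) w z := by
  have h : bracket ℤ (u : Cycle (Letter n)) (ofCycle ℤ (w : Cycle (Letter n)))
      (ofCycle ℤ (z : Cycle (Letter n))) = bracketSum ℤ (u : Cycle (Letter n)) w z := by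
    refine eq_of_smul_toClasses_eq two_ne_zero ?_
    rw [two_smul_toClasses_bracket hn hu, two_smul_toClasses_bracketSum hn hu hw hz,
      toClasses_ofCycle hw, toClasses_ofCycle hz, cycleCls_coe, cycleCls_coe, loopBracket_cls]
  have := neZero_length hw
  have := neZero_length hz
  rw [← extendScalars_ofCycle k (w : Cycle (Letter n)),
    ← extendScalars_ofCycle k (z : Cycle (Letter n)), ← extendScalars_bracket k hn hu, h,
    extendScalars_bracketSum k _ (LP_finite hn hu (isReducedClosed hw) (isReducedClosed hz))]

theorem bracket_swap (hn : u.Nodup) (hu : ∀ x, x ∈ u) (x y : V k n) :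
    bracket k (u : Cycle (Letter n)) x y = -bracket k (u : Cycle (Letter n)) y x := by
  induction x using Finsupp.induction_linear with
  | zero => simp
  | add x x' hx hx' => rw [map_add, map_add, LinearMap.add_apply, hx, hx', neg_add]
  | single W a =>
    induction y using Finsupp.induction_linear with
    | zero => simp
    | add y y' hy hy' => rw [map_add, map_add, LinearMap.add_apply, hy, hy', neg_add]
    | single Z b =>
      rw [← mul_one a, ← mul_one b, ← smul_eq_mul, ← smul_eq_mul, ← Finsupp.smul_single,
        ← Finsupp.smul_single]
      simp only [map_smul, LinearMap.smul_apply, ← extendScalars_single k,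
        ← extendScalars_bracket k hn hu]
      rw [bracket_int_single_swap hn hu, map_neg, smul_neg, smul_neg, smul_comm]

theorem bracket_self (hn : u.Nodup) (hu : ∀ x, x ∈ u) (x : V k n) :
    bracket k (u : Cycle (Letter n)) x x = 0 := by
  induction x using Finsupp.induction_linear with
  | zero => simp
  | add x y hx hy =>
    rw [map_add, map_add, LinearMap.add_apply, LinearMap.add_apply, hx, hy,
      bracket_swap k hn hu x y]
    simp
  | single W a =>
    rw [← mul_one a, ← smul_eq_mul, ← Finsupp.smul_single, map_smul, map_smul,
      LinearMap.smul_apply, ← extendScalars_single k, ← extendScalars_bracket k hn hu,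
      bracket_int_single_self hn hu, map_zero, smul_zero, smul_zero]

theorem bracket_jacobi (hn : u.Nodup) (hu : ∀ x, x ∈ u) (x y z : V k n) :
    bracket k (u : Cycle (Letter n)) x (bracket k (u : Cycle (Letter n)) y z) +
      bracket k (u : Cycle (Letter n)) y (bracket k (u : Cycle (Letter n)) z x) +
      bracket k (u : Cycle (Letter n)) z (bracket k (u : Cycle (Letter n)) x y) = 0 := by
  induction x using Finsupp.induction_linear with
  | zero => simp
  | add x x' hx hx' =>
    refine Eq.trans ?_ ((congrArg₂ (· + ·) hx hx').trans (add_zero 0))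
    simp only [map_add, LinearMap.add_apply]
    abel
  | single X a =>
    induction y using Finsupp.induction_linear with
    | zero => simp
    | add y y' hy hy' =>
      refine Eq.trans ?_ ((congrArg₂ (· + ·) hy hy').trans (add_zero 0))
      simp only [map_add, LinearMap.add_apply]
      abel
    | single Y b =>
      induction z using Finsupp.induction_linear with
      | zero => simp
      | add z z' hz hz' =>
        refine Eq.trans ?_ ((congrArg₂ (· + ·) hz hz').trans (add_zero 0))
        simp only [map_add, LinearMap.add_apply]
        abel
      | single Z c =>
        have h := congrArg (extendScalars k) (bracket_int_single_jacobi hn hu X Y Z)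
        simp only [map_add, extendScalars_bracket k hn hu, extendScalars_single, map_zero] at h
        have hs : ∀ (W : ReducedCyclicWord n) (r : k),
            Finsupp.single W r = r • Finsupp.single W 1 := fun W r => by simp
        rw [hs X a, hs Y b, hs Z c]
        simp only [map_smul, LinearMap.smul_apply]
        refine Eq.trans ?_ ((congrArg (fun v => (a * b * c) • v) h).trans (smul_zero _))
        module

end ExtensionOfScalars

end CyclicWords

open CyclicWords in
/-- The bracket of reduced cyclic words is well defined (the sets of linked pairs are finite, the
words `γ(P, Q)` are reduced cyclic words, and the formula for the bracket holds for every choice of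
linear representatives), and it makes `𝕍` a Lie algebra. -/
theorem theoremt2 (k : Type*) [CommRing k] (n : ℕ) (O : Cycle (Letter n))
    (hO : IsSurfaceSymbol O) :
    (∀ (w z : List (Letter n)),
      IsReducedCyclic (w : Cycle (Letter n)) → IsReducedCyclic (z : Cycle (Letter n)) →
      (LP O w z).Finite ∧
      (∀ x ∈ LP O w z, IsReducedCyclic (gamma O w z x)) ∧
      (∀ x ∈ LP O w z, Linked3 O (subword w x.1 x.2.2) (subword z x.2.1 x.2.2) →
        x.2.2 ≤ w.length → x.2.2 ≤ z.length →
        gamma O w z x =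
          (((w.rotate (x.1 + x.2.2 + 1)).take (w.length - x.2.2) ++
            (z.rotate (x.2.1 + x.2.2 + 1)).take (z.length - x.2.2) : List (Letter n)) :
            Cycle (Letter n))) ∧
      bracket k O (ofCycle k (w : Cycle (Letter n))) (ofCycle k (z : Cycle (Letter n))) =
        ∑ᶠ x ∈ LP O w z, signLP O w z x • ofCycle k (gamma O w z x)) ∧
    (∀ x : V k n, bracket k O x x = 0) ∧
    (∀ x y : V k n, bracket k O x y = -bracket k O y x) ∧
    (∀ x y z : V k n,
      bracket k O x (bracket k O y z) + bracket k O y (bracket k O z x) +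
        bracket k O z (bracket k O x y) = 0) := by
  induction O using Quotient.inductionOn with
  | h u =>
    have hn : u.Nodup := Cycle.nodup_coe_iff.1 hO.1
    have hu : ∀ x, x ∈ u := fun x => Cycle.mem_coe_iff.1 (hO.2 x)
    refine ⟨fun w z hw hz => ?_, bracket_self k hn hu, bracket_swap k hn hu,
      bracket_jacobi k hn hu⟩
    have := neZero_length hw
    have := neZero_length hz
    have hW := isReducedClosed hw
    have hZ := isReducedClosed hz
    exact ⟨LP_finite hn hu hW hZ, isReducedCyclic_gamma hn hu hW hZ,
      fun x _ h3 => gamma_of_linked3_of_le hn hu hW hZ x h3, bracket_ofCycle k hn hu hw hz⟩
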